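/- Let $\Lambda$ be the weight lattice of a semisimple (finite, reduced, crystallographic) root system of rank $n$ with Weyl group $W$ and a chosen base, with fundamental weights $\omega_1,\dots,\omega_n$. Let $T^*$ be a subgroup of $\Lambda$ of index $2$ that contains the root lattice (the character lattice of a split maximal torus of a semisimple group), and number the fundamental weights so that $\omega_1,\dots,\omega_{n'}\notin T^*$ and $\omega_{n'+1},\dots,\omega_n\in T^*$. For $\omega\in\Lambda$ put $\rho(\omega)=\sum_{\lambda\in W(\omega)}e^\lambda\in\mathbb Z[\Lambda]$, and let $s_i=|W(\omega_i)|$ and $\rho_i=\rho(\omega_i)-s_i$. Let $I_{sc}^W$ be the ideal of $\mathbb Z[\Lambda]$ generated by the $W$-invariant elements in the kernel of the augmentation $\mathbb Z[\Lambda]\to\mathbb Z$, $e^\lambda\mapsto 1$. For a $\mathbb Z$-basis $x_1,\dots,x_n$ of $\Lambda$ let $\Lambda_i=\mathbb Zx_1\oplus\dots\oplus\mathbb Zx_i$. A tuple $(q_1,\dots,q_n)$ in $\mathbb Z[\Lambda]$ satisfies the flatness condition with respect to $x_1,\dots,x_n$ if for every $i$ one has $q_i\in\mathbb Z[\Lambda_i]$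 and the coefficient in $\mathbb Z[\Lambda_{i-1}]$ of the highest power of $e^{x_i}$ occurring in $q_i$ is a monic monomial $e^\mu$, $\mu\in\Lambda_{i-1}$. It satisfies the generalized flatness condition if $(q_1,\dots,q_n)A$ satisfies the flatness condition for some $A\in GL_n(\mathbb Z[\Lambda])$. For $1\le i\le n'$ let $d_i=\gcd(s_i,\dots,s_{n'})$, choose integers $a_{i,j}$ with $d_i=\sum_{j=i}^{n'}a_{i,j}s_j$, and put $\tilde\rho_i=\sum_{j=i}^{n'}a_{i,j}\rho_j$ and $\tilde\rho(\omega_i)=\tilde\rho_i+d_i$. Choose $\lambda_0\in\Lambda\setminus T^*$, and let $r_i=\operatorname{lcm}(s_i,d_{i+1})$ for $1\le i<n'$. Define $$h_{1,i}=e^{\lambda_0}\Bigl(\tfrac{r_i}{s_i}\rho(\omega_i)-\tfrac{r_i}{d_{i+1}}\tilde\rho(\omega_{i+1})\Bigr)\ (1\le i<n'),\qquad h_{2,i}=\rho(\omega_i)\tilde\rho(\omega_1)-d_1s_i\ (1\le i\le n'),\qquad h_{3,i}=\rho_i\ (n'<i\le n).$$ Theorem. If $(\rho_1,\dots,\rho_n)$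 satisfies the generalized flatness condition with respect to some basis $x_1,\dots,x_n$ of $\Lambda$, then, for all choices of the $a_{i,j}$ and of $\lambda_0$ as above, the elements $h_{k,i}$ lie in $\mathbb Z[T^*]$ and generate the ideal $I_{sc}^W\cap\mathbb Z[T^*]$ of $\mathbb Z[T^*]$. -/

import Mathlib

open scoped AddMonoidAlgebra

noncomputable section

/-! ### Flatness conditions for tuples of Laurent polynomials

`R[Λ]` is the group ring of a free abelian group `Λ` with a `ℤ`-basis `x`.  The integer
`x.repr l i` is the exponent of `x_i` in the monomial `e ^ l`. -/

section Flatness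

variable {R Λ : Type*} [CommRing R] [AddCommGroup Λ] {n : ℕ}

/-- `p` lies in `R[Λ_i]`, where `Λ_i` is spanned by the basis vectors of index at most `i`. -/
def IsLaurentIn (x : Module.Basis (Fin n) ℤ Λ) (i : Fin n) (p : R[Λ]) : Prop :=
  ∀ l ∈ p.coeff.support, ∀ j : Fin n, i < j → x.repr l j = 0

/-- `p` is a divisor with respect to `x_i`: the coefficient of the highest power of `x_i` that
occurs in `p` is a monic monomial, i.e. exactly one term of `p` has the highest degree in `x_i`,
and this term has coefficient `1`. -/
def IsLaurentDivisor (x : Module.Basis (Fin n) ℤ Λ) (i : Fin n) (p : R[Λ]) : Prop :=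
  ∃ m : Λ, p.coeff m = 1 ∧ ∀ l ∈ p.coeff.support, l ≠ m → x.repr l i < x.repr m i

/-- The flatness condition: `q_i ∈ R[Λ_i]` and `q_i` is a divisor with respect to `x_i`. -/
def FlatnessCondition (x : Module.Basis (Fin n) ℤ Λ) (q : Fin n → R[Λ]) : Prop :=
  ∀ i, IsLaurentIn x i (q i) ∧ IsLaurentDivisor x i (q i)

/-- The generalized flatness condition: `(q_1, …, q_n) A` satisfies the flatness condition for
some `A ∈ GL_n(R[Λ])`. -/
def GeneralizedFlatnessCondition (x : Module.Basis (Fin n) ℤ Λ) (q : Fin n → R[Λ]) : Prop :=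
  ∃ A : Matrix.GeneralLinearGroup (Fin n) R[Λ],
    FlatnessCondition x (Matrix.vecMul q (A : Matrix (Fin n) (Fin n) R[Λ]))

end Flatness

/-! ### The weight lattice and the action of the Weyl group -/

namespace RootPairing

variable {ι k M N : Type*} [Field k] [AddCommGroup M] [Module k M] [AddCommGroup N] [Module k N]

/-- The weight lattice: vectors that pair integrally with all coroots. -/
def weightLattice (P : RootPairing ι k M N) : AddSubgroup M where
  carrier := {v | ∀ i, ∃ z : ℤ, P.coroot' i v = z}
  zero_mem' := fun i => ⟨0, by simp⟩
  add_mem' := by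
    intro v w hv hw i
    obtain ⟨a, ha⟩ := hv i
    obtain ⟨c, hc⟩ := hw i
    exact ⟨a + c, by rw [map_add, ha, hc]; push_cast; rfl⟩
  neg_mem' := by
    intro v hv i
    obtain ⟨a, ha⟩ := hv i
    exact ⟨-a, by rw [map_neg, ha]; push_cast; rfl⟩

/-- A root, as an element of the weight lattice. -/
def rootWeight (P : RootPairing ι k M N) [P.IsCrystallographic] (i : ι) : P.weightLattice :=
  ⟨P.root i, fun j => by
    obtain ⟨z, hz⟩ := P.exists_value (S := ℤ) i j
    exact ⟨z, by simpa using hz.symm⟩⟩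

lemma weylGroup_smul_mem_weightLattice (P : RootPairing ι k M N) [P.IsCrystallographic]
    (g : P.weylGroup) {v : M} (hv : v ∈ P.weightLattice) : g • v ∈ P.weightLattice := by
  obtain ⟨g, hg⟩ := g
  induction hg using weylGroup.induction generalizing v with
  | mem i =>
    have h : P.reflection i v ∈ P.weightLattice := by
      obtain ⟨z, hz⟩ := hv i
      rw [P.reflection_apply, hz, Int.cast_smul_eq_zsmul]
      exact sub_mem hv (zsmul_mem (P.rootWeight i).2 z)
    exact h
  | one => exact hv
  | mul x y hx hy ihx ihy => exact ihx (ihy hv)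

/-- The action of the Weyl group on the weight lattice. -/
instance weightLatticeAction (P : RootPairing ι k M N) [P.IsCrystallographic] :
    MulAction P.weylGroup P.weightLattice where
  smul g l := ⟨g • (l : M), P.weylGroup_smul_mem_weightLattice g l.2⟩
  one_smul l := Subtype.ext (one_smul P.weylGroup (l : M))
  mul_smul g h l := Subtype.ext (mul_smul g h (l : M))

/-- The Weyl group of a finite root system is finite. -/
instance finite_weylGroup (P : RootPairing ι k M N) [P.IsRootSystem] [Finite ι] :
    Finite P.weylGroup := by
  refine Finite.of_injective (fun g : P.weylGroup => P.weylGroupToPerm g) ?_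
  intro g h hgh
  have hgh' : P.weylGroupToPerm g = P.weylGroupToPerm h := hgh
  refine Subtype.ext (Equiv.weightHom_injective P (LinearEquiv.toLinearMap_injective ?_))
  refine LinearMap.ext_on_range (v := P.root) IsRootSystem.span_root_eq_top fun i => ?_
  have h1 := P.weylGroup_apply_root g i
  rw [hgh', ← P.weylGroup_apply_root h i] at h1
  exact h1

/-- The number of elements of the Weyl group orbit of a weight. -/
def orbitCard (P : RootPairing ι k M N) [P.IsCrystallographic] (l : P.weightLattice) : ℕ :=
  (MulAction.orbit P.weylGroup l).ncard

/-- The orbit sum `ρ(l)`, the sum of all `e ^ m` with `m` in the Weyl group orbit of `l`. -/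
def orbitSum (P : RootPairing ι k M N) [P.IsRootSystem] [P.IsCrystallographic] [Finite ι]
    (l : P.weightLattice) : ℤ[P.weightLattice] :=
  ∑ m ∈ (Set.finite_range fun g : P.weylGroup => g • l).toFinset, AddMonoidAlgebra.single m 1

/-- The augmented orbit sum `ρ(l) - |W(l)|`. -/
def augOrbitSum (P : RootPairing ι k M N) [P.IsRootSystem] [P.IsCrystallographic] [Finite ι]
    (l : P.weightLattice) : ℤ[P.weightLattice] :=
  P.orbitSum l - (P.orbitCard l : ℤ[P.weightLattice])

/-- The augmentation `ℤ[Λ] → ℤ`, sending every `e ^ l` to `1`. -/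
def augmentation (P : RootPairing ι k M N) : ℤ[P.weightLattice] →ₐ[ℤ] ℤ :=
  AddMonoidAlgebra.lift ℤ ℤ P.weightLattice 1

/-- The ideal of `ℤ[Λ]` generated by the Weyl group invariant elements of augmentation zero. -/
def invariantIdeal (P : RootPairing ι k M N) [P.IsCrystallographic] :
    Ideal ℤ[P.weightLattice] :=
  Ideal.span {f | (∀ g : P.weylGroup, AddMonoidAlgebra.mapDomain (g • ·) f = f) ∧
    P.augmentation f = 0}

/-- The inclusion `ℤ[T] → ℤ[Λ]` for a subgroup `T` of the weight lattice. -/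
def sublatticeInclusion {P : RootPairing ι k M N} (T : AddSubgroup P.weightLattice) :
    ℤ[T] →+* ℤ[P.weightLattice] :=
  AddMonoidAlgebra.mapDomainRingHom ℤ T.subtype

/-! ### Fundamental weights -/

namespace Base

variable {P : RootPairing ι k M N} [P.IsRootSystem]

/-- The vector dual to the simple coroots, i.e. a fundamental weight as an element of `M`. -/
def fundamentalVector (b : P.Base) (i : b.support) : M :=
  P.toPerfPair.symm (b.toCoweightBasis.coord i)

open Classical in
lemma coroot'_fundamentalVector (b : P.Base) (i j : b.support) :
    P.coroot' j (b.fundamentalVector i) = if j = i then 1 else 0 := by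
  have h : P.coroot' j (b.fundamentalVector i) =
      P.toPerfPair (b.fundamentalVector i) (P.coroot j) := rfl
  rw [h, fundamentalVector, LinearEquiv.apply_symm_apply, Module.Basis.coord_apply,
    toCoweightBasis_repr_coroot, Finsupp.single_apply]

/-- The fundamental weight `ω_i` of a base: its pairing with the `j`-th simple coroot is `1` if
`j = i` and `0` otherwise. -/
def fundamentalWeight (b : P.Base) (i : b.support) : P.weightLattice :=
  ⟨b.fundamentalVector i, fun j => by
    classical
    have key : ∀ y ∈ Submodule.span ℤ (P.coroot '' b.support),
        ∃ z : ℤ, P.toLinearMap (b.fundamentalVector i) y = z := by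
      intro y hy
      induction hy using Submodule.span_induction with
      | mem y hy =>
        obtain ⟨l, hl, rfl⟩ := hy
        have h := b.coroot'_fundamentalVector i ⟨l, hl⟩
        by_cases hli : (⟨l, hl⟩ : b.support) = i
        · exact ⟨1, by rw [if_pos hli] at h; simpa using h⟩
        · exact ⟨0, by rw [if_neg hli] at h; simpa using h⟩
      | zero => exact ⟨0, by simp⟩
      | add y z _ _ hy hz =>
        obtain ⟨a, ha⟩ := hy
        obtain ⟨c, hc⟩ := hz
        exact ⟨a + c, by rw [map_add, ha, hc]; push_cast; rfl⟩
      | smul m y _ hy =>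
        obtain ⟨a, ha⟩ := hy
        exact ⟨m * a, by rw [map_zsmul, ha, zsmul_eq_mul]; push_cast; rfl⟩
    exact key _ (b.coroot_mem_span_int j)⟩

end Base

end RootPairing

/-! ### The list of generators

In this part `n'` is the number of fundamental weights of degree `1`, and these come first.
Indices in `Fin n` start at `0`. -/

section Generators

variable {n : ℕ}

/-- The set of indices `j` with `i ≤ j < n'`. -/
def tailIndices (n' : ℕ) (i : Fin n) : Finset (Fin n) :=
  Finset.univ.filter fun j => i ≤ j ∧ (j : ℕ) < n'

/-- `d_i`, the greatest common divisor of all `s_j` with `i ≤ j < n'`. -/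
def tailGcd (n' : ℕ) (s : Fin n → ℕ) (i : Fin n) : ℕ :=
  (tailIndices n' i).gcd s

/-- The integers `a i j`, `i ≤ j < n'`, present each `d_i`, `i < n'`, as an integral combination
of the `s_j`.  (The other values of `a` play no role.) -/
def IsGcdPresentation (n' : ℕ) (s : Fin n → ℕ) (a : Fin n → Fin n → ℤ) : Prop :=
  ∀ i : Fin n, (i : ℕ) < n' → (tailGcd n' s i : ℤ) = ∑ j ∈ tailIndices n' i, a i j * (s j : ℤ)

namespace RootPairing

variable {ι k M N : Type*} [Field k] [AddCommGroup M] [Module k M] [AddCommGroup N] [Module k N]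
  (P : RootPairing ι k M N) [P.IsRootSystem] [P.IsCrystallographic] [Finite ι]
  (w : Fin n → P.weightLattice) (n' : ℕ) (a : Fin n → Fin n → ℤ) (l₀ : P.weightLattice)

/-- `ρ̃_i`, the sum of all `a i j • ρ_j` with `i ≤ j < n'`. -/
def tildeAugOrbitSum (i : Fin n) : ℤ[P.weightLattice] :=
  ∑ j ∈ tailIndices n' i, a i j • P.augOrbitSum (w j)

/-- `ρ̃(ω_i) = ρ̃_i + d_i`. -/
def tildeOrbitSum (i : Fin n) : ℤ[P.weightLattice] :=
  P.tildeAugOrbitSum w n' a i +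
    (tailGcd n' (fun j => P.orbitCard (w j)) i : ℤ[P.weightLattice])

/-- `h_{1,i}`, with `i'` the successor of `i`; here `r_i = lcm(s_i, d_{i'})`, so both divisions
of natural numbers are exact. -/
def genOne (i i' : Fin n) : ℤ[P.weightLattice] :=
  let s : Fin n → ℕ := fun j => P.orbitCard (w j)
  let r : ℕ := Nat.lcm (s i) (tailGcd n' s i')
  AddMonoidAlgebra.single l₀ 1 *
    ((r / s i) • P.orbitSum (w i) - (r / tailGcd n' s i') • P.tildeOrbitSum w n' a i')

/-- `h_{2,i}`, with `i₁` the first index. -/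
def genTwo (i₁ i : Fin n) : ℤ[P.weightLattice] :=
  let s : Fin n → ℕ := fun j => P.orbitCard (w j)
  P.orbitSum (w i) * P.tildeOrbitSum w n' a i₁ -
    ((tailGcd n' s i₁ * s i : ℕ) : ℤ[P.weightLattice])

/-- The list of all elements `h_{1,i}`, `h_{2,i}` and `h_{3,i}`. -/
def generatorSet : Set ℤ[P.weightLattice] :=
  {h | ∃ i i' : Fin n, (i' : ℕ) = i + 1 ∧ (i' : ℕ) < n' ∧ h = P.genOne w n' a l₀ i i'} ∪
  {h | ∃ i₁ i : Fin n, (i₁ : ℕ) = 0 ∧ (i : ℕ) < n' ∧ h = P.genTwo w n' a i₁ i} ∪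
  {h | ∃ i : Fin n, n' ≤ (i : ℕ) ∧ h = P.augOrbitSum (w i)}

end RootPairing

end Generators

end

/-! Call an element of ℤ[Λ] even if it is supported on `T`, odd if it is supported on the
complement. Number from 1 and write d = d_1, Y = ρ̃(ω_1), q_i = ρ_i. By `invariantIdeal_eq_span` the
ideal in question is I = (q_1, …, q_n), because the orbit sums of the fundamental weights generate
the ring of invariants.

The q_i with i ≤ n' are neither even nor odd, and this is the difficulty. Put t_i = s_i / d for i ≤
n' and t_i = 0 otherwise, and let K be generated by all q_i - t_i (Y - d). These elements are ρ(ω_i)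
- t_i Y, which is odd, for i ≤ n', and ρ_i, which is even, for i > n'. So K is stable under taking
even parts, and I = K + (Y - d). Let f in I be even, f ≡ (Y - d) x modulo K, and let x₀, x₁ be the
even and odd parts of x. The odd part of this congruence is Y x₀ ≡ d x₁. If d and Y have only
trivial relations modulo K, then x₀ ≡ m d and x₁ ≡ m Y, hence f ≡ m (Y² - d²). This is
`mem_span_of_koszulExact`.

The triviality of those relations is deduced in `exists_sub_mul_mem_of_koszulExact` from the
vanishing of the first Koszul homology of d, q_1, …, q_n. Under the flatness condition this sequence
is regular: the earlier terms do not involve x_i, and q_i has a unit as its leading coefficient in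
x_i (`mem_of_mul_mem_of_leading`). A change of coordinates in GL_n preserves the vanishing.

It remains to express K and Y² - d² by the h_{k,i}. The odd generators of K are combinations ∑ c_j
ρ(ω_j) with ∑ c_j s_j = 0, and such relations are generated by those behind the h_{1,i}
(`sum_zsmul_mem_of_relations`); the unit e^{λ₀} only corrects the parity. Moreover Y² - d² = ∑
a_{1,i} h_{2,i}. Finally, taking even parts is ℤ[T]-linear, so coefficients can be chosen in ℤ[T]
(`mem_span_preimage_of_mem_span`). -/

set_option linter.unusedSectionVars false

noncomputable section

/-! ### Relations between the values of a linear form -/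

section Koszul

variable {R F F' : Type*} [CommRing R] [AddCommGroup F] [Module R F]
  [AddCommGroup F'] [Module R F']

/-- Every relation between the values of the linear form `φ` is a combination of trivial ones:
the first Koszul homology of `φ` vanishes. -/
def KoszulExact (φ : F →ₗ[R] R) : Prop :=
  LinearMap.ker φ ≤ Submodule.span R (Set.range fun p : F × F => φ p.1 • p.2 - φ p.2 • p.1)

lemma KoszulExact.comp_equiv {φ : F →ₗ[R] R} (h : KoszulExact φ) (e : F' ≃ₗ[R] F) :
    KoszulExact (φ ∘ₗ e.toLinearMap) := by
  intro z hz
  have hz' : e z ∈ Submodule.span R (Set.range fun p : F × F => φ p.1 • p.2 - φ p.2 • p.1) :=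
    h hz
  have h1 := Submodule.mem_map_of_mem (f := e.symm.toLinearMap) hz'
  rw [Submodule.map_span] at h1
  simp only [LinearEquiv.coe_coe, LinearEquiv.symm_apply_apply] at h1
  refine Submodule.span_mono ?_ h1
  rintro _ ⟨_, ⟨⟨u, v⟩, rfl⟩, rfl⟩
  exact ⟨(e.symm u, e.symm v), by simp⟩

/-- Adjoining a value that is regular modulo the previous ones. -/
lemma KoszulExact.coprod_toSpanSingleton {φ : F →ₗ[R] R} (h : KoszulExact φ) {c : R}
    (hc : ∀ r, c * r ∈ LinearMap.range φ → r ∈ LinearMap.range φ) :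
    KoszulExact (φ.coprod (LinearMap.toSpanSingleton R R c)) := by
  rintro ⟨u, r⟩ hz
  have hz' : φ u + r * c = 0 := by simpa using hz
  -- The relation puts `c * r` in the range of `φ`, so `r = φ v` by regularity. Then `(u, r)`
  -- differs from the old relation `(u + c • v, 0)` by a trivial one between `(v, 0)` and `(0, 1)`.
  obtain ⟨v, rfl⟩ := hc r ⟨-u, by rw [map_neg]; linear_combination -hz'⟩
  have hk : u + c • v ∈ LinearMap.ker φ := by
    rw [LinearMap.mem_ker, map_add, map_smul, smul_eq_mul]; linear_combination hz'
  have h1 := Submodule.mem_map_of_mem (f := LinearMap.inl R F R) (h hk)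
  rw [Submodule.map_span] at h1
  have h2 : (u, φ v) = LinearMap.inl R F R (u + c • v) +
      (φ v • ((0 : F), (1 : R)) - c • (v, (0 : R))) := by
    ext <;> simp
  rw [h2]
  refine add_mem (Submodule.span_mono ?_ h1) (Submodule.subset_span ⟨((v, 0), (0, 1)), by simp⟩)
  rintro _ ⟨_, ⟨⟨u, v⟩, rfl⟩, rfl⟩
  exact ⟨((u, 0), (v, 0)), by simp⟩

/-- The linear form with values `c`, `q_1`, …, `q_n` at the standard basis of `R × R ^ n`. -/
def consForm {n : ℕ} (c : R) (q : Fin n → R) : R × (Fin n → R) →ₗ[R] R :=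
  (LinearMap.toSpanSingleton R R c).coprod (Fintype.linearCombination R q)

lemma consForm_apply {n : ℕ} (c : R) (q : Fin n → R) (z : R × (Fin n → R)) :
    consForm c q z = z.1 * c + ∑ i, z.2 i * q i := by
  simp [consForm, Fintype.linearCombination_apply]

lemma range_consForm {n : ℕ} (c : R) (q : Fin n → R) :
    LinearMap.range (consForm c q) = Ideal.span ({c} ∪ Set.range q) := by
  rw [consForm, LinearMap.range_coprod, LinearMap.range_toSpanSingleton,
    Fintype.range_linearCombination, Ideal.span, Submodule.span_union]

/-- Splitting off the last coordinate. -/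
def prodPiSuccEquiv (R : Type*) [CommRing R] (n : ℕ) :
    (R × (Fin (n + 1) → R)) ≃ₗ[R] (R × (Fin n → R)) × R where
  toFun z := ((z.1, fun i => z.2 i.castSucc), z.2 (Fin.last n))
  invFun z := (z.1.1, Fin.snoc (α := fun _ => R) z.1.2 z.2)
  map_add' _ _ := rfl
  map_smul' _ _ := rfl
  left_inv z := by
    ext i
    · rfl
    · refine Fin.lastCases ?_ (fun j => ?_) i <;> simp
  right_inv z := by ext <;> simp

/-- Regular sequences have vanishing first Koszul homology; the last term is adjoined by
`KoszulExact.coprod_toSpanSingleton`. -/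
lemma koszulExact_consForm {n : ℕ} (c : R) (q : Fin n → R) (hc : ∀ f, c * f = 0 → f = 0)
    (hq : ∀ i f, q i * f ∈ Ideal.span ({c} ∪ q '' {j | j < i}) →
      f ∈ Ideal.span ({c} ∪ q '' {j | j < i})) :
    KoszulExact (consForm c q) := by
  induction n with
  | zero =>
    rintro ⟨u, v⟩ hz
    have hz' : u * c = 0 := by simpa [consForm_apply] using hz
    have hu : u = 0 := hc u (by rw [mul_comm]; exact hz')
    have : ((u, v) : R × (Fin 0 → R)) = 0 := by ext i; exacts [hu, i.elim0]
    rw [this]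
    exact zero_mem _
  | succ n ih =>
    have himage : ∀ i : Fin n, (fun j : Fin n => q j.castSucc) '' {j | j < i} =
        q '' {j | j < i.castSucc} := by
      intro i
      ext y
      constructor
      · rintro ⟨j, hj, rfl⟩
        exact ⟨j.castSucc, by simpa using hj, rfl⟩
      · rintro ⟨j, hj, rfl⟩
        have hj' : (j : ℕ) < i := hj
        exact ⟨⟨j, by omega⟩, hj', rfl⟩
    have himage' : Set.range (fun j : Fin n => q j.castSucc) = q '' {j | j < Fin.last n} := by
      ext y
      constructor
      · rintro ⟨j, rfl⟩
        exact ⟨j.castSucc, j.castSucc_lt_last, rfl⟩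
      · rintro ⟨j, hj, rfl⟩
        have hj' : (j : ℕ) < n := hj
        exact ⟨⟨j, hj'⟩, rfl⟩
    have h1 := ih (fun j => q j.castSucc) (fun i f => by
      rw [himage]; exact hq i.castSucc f)
    have h2 := h1.coprod_toSpanSingleton (c := q (Fin.last n)) (by
      rw [range_consForm, himage']; exact hq (Fin.last n))
    have h3 := h2.comp_equiv (prodPiSuccEquiv R n)
    convert h3 using 1
    ext z
    · simp [consForm_apply, prodPiSuccEquiv]
    · simp [consForm_apply, prodPiSuccEquiv, Fin.sum_univ_castSucc]

end Koszul

/-! ### Restriction of the support -/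

section Restrict

variable {R Λ : Type*} [CommRing R]

open Classical in
/-- The part of `f` supported on the elements with the property `p`. -/
def restrictSupport (p : Λ → Prop) : R[Λ] →+ R[Λ] :=
  (AddMonoidAlgebra.coeffAddEquiv (R := R) (M := Λ)).symm.toAddMonoidHom.comp
    ((Finsupp.filterAddHom p).comp AddMonoidAlgebra.coeffAddEquiv.toAddMonoidHom)

open Classical in
lemma coeff_restrictSupport (p : Λ → Prop) (f : R[Λ]) (m : Λ) :
    (restrictSupport p f).coeff m = if p m then f.coeff m else 0 := by
  exact Finsupp.filter_apply p f.coeff m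

variable [AddCommGroup Λ]

/-- Translation by the support of `q` carries `p'` to `p`. The two predicates differ when `q` is
odd; they agree when `q` is even or has degree zero in a variable. -/
lemma restrictSupport_mul {p p' : Λ → Prop} {q : R[Λ]}
    (hq : ∀ l ∈ q.coeff.support, ∀ m, p (l + m) ↔ p' m) (f : R[Λ]) :
    restrictSupport p (q * f) = q * restrictSupport p' f := by
  classical
  ext g
  rw [coeff_restrictSupport, AddMonoidAlgebra.coeff_mul_apply_left,
    AddMonoidAlgebra.coeff_mul_apply_left, Finsupp.sum, Finsupp.sum]
  split_ifs with hg
  · refine Finset.sum_congr rfl fun l hl => ?_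
    rw [coeff_restrictSupport, if_pos ((hq l hl _).1 (by simpa using hg))]
  · symm
    refine Finset.sum_eq_zero fun l hl => ?_
    rw [coeff_restrictSupport, if_neg (fun h => hg (by simpa using (hq l hl _).2 h)), mul_zero]

/-- An ideal with homogeneous generators contains the homogeneous components of its elements. This
serves both the degree in x_i and the parity. -/
lemma restrictSupport_mem_span {p : Λ → Prop} {S : Set R[Λ]}
    (hS : ∀ s ∈ S, ∃ p' : Λ → Prop, ∀ l ∈ s.coeff.support, ∀ m, p (l + m) ↔ p' m) {f : R[Λ]}
    (hf : f ∈ Ideal.span S) : restrictSupport p f ∈ Ideal.span S := by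
  obtain ⟨c, rfl⟩ := (Finsupp.mem_span_iff_linearCombination R[Λ] S f).1 hf
  rw [Finsupp.linearCombination_apply, Finsupp.sum, map_sum]
  refine sum_mem fun s _ => ?_
  obtain ⟨p', hp'⟩ := hS s s.2
  rw [smul_eq_mul, mul_comm, restrictSupport_mul hp']
  exact Ideal.mul_mem_right _ _ (Ideal.subset_span s.2)

end Restrict

/-! ### Flatness and regularity -/

section Flatness

variable {R Λ : Type*} [CommRing R] [AddCommGroup Λ]

/-- The top component of `q * f` is a unit monomial times the top component of `f`. Since `I` is
homogeneous, the latter lies in `I`; subtracting it shrinks the support of `f`. -/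
lemma mem_of_mul_mem_of_leading (deg : Λ →+ ℤ) (I : Ideal R[Λ])
    (hI : ∀ f ∈ I, ∀ t, restrictSupport (fun l => deg l = t) f ∈ I) {q : R[Λ]} {m : Λ}
    (hm : q.coeff m = 1) (hlt : ∀ l ∈ q.coeff.support, l ≠ m → deg l < deg m) {f : R[Λ]}
    (hf : q * f ∈ I) : f ∈ I := by
  classical
  induction hk : f.coeff.support.card using Nat.strong_induction_on generalizing f with
  | _ k ih =>
  by_cases hf0 : f = 0
  · rw [hf0]; exact zero_mem _
  obtain ⟨t₀, ht₀, hmax⟩ := Finset.exists_max_image f.coeff.support deg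
    (by rwa [Finsupp.support_nonempty_iff, Ne, AddMonoidAlgebra.coeff_eq_zero])
  set g := restrictSupport (fun l => deg l = deg t₀) f with hg
  -- Only the leading term of `q` times the top layer of `f` reaches this degree.
  have htop : restrictSupport (fun l => deg l = deg m + deg t₀) (q * f) =
      AddMonoidAlgebra.single m 1 * g := by
    ext l
    rw [coeff_restrictSupport, AddMonoidAlgebra.coeff_mul_apply_left,
      AddMonoidAlgebra.coeff_single_mul_apply, one_mul, hg, coeff_restrictSupport, map_add, map_neg]
    by_cases hl : deg l = deg m + deg t₀
    · rw [if_pos hl, if_pos (by omega), Finsupp.sum, Finset.sum_eq_single m]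
      · rw [hm, one_mul]
      · intro a ha ham
        have h1 := hlt a ha ham
        have h2 : -a + l ∉ f.coeff.support := by
          intro hmem
          have h3 := hmax _ hmem
          rw [map_add, map_neg] at h3
          omega
        rw [Finsupp.notMem_support_iff.1 h2, mul_zero]
      · intro hmem
        rw [Finsupp.notMem_support_iff.1 hmem, zero_mul]
    · rw [if_neg hl, if_neg (by omega)]
  have hgI : g ∈ I := by
    have h1 := hI _ hf (deg m + deg t₀)
    rw [htop] at h1
    have h2 := I.mul_mem_left (AddMonoidAlgebra.single (-m) 1) h1
    rwa [← mul_assoc, AddMonoidAlgebra.single_mul_single, neg_add_cancel, one_mul,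
      ← AddMonoidAlgebra.one_def, one_mul] at h2
  have hcard : (f - g).coeff.support.card < k := by
    rw [← hk]
    refine Finset.card_lt_card (Finset.ssubset_iff_of_subset ?_ |>.2 ⟨t₀, ht₀, ?_⟩)
    · intro l hl
      rw [Finsupp.mem_support_iff] at hl ⊢
      intro h0
      apply hl
      rw [AddMonoidAlgebra.coeff_sub, Finsupp.sub_apply, hg, coeff_restrictSupport, h0]
      simp
    · rw [Finsupp.notMem_support_iff, AddMonoidAlgebra.coeff_sub, Finsupp.sub_apply, hg,
        coeff_restrictSupport, if_pos rfl, sub_self]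
  have := ih _ hcard (f := f - g) (by rw [mul_sub]; exact I.sub_mem hf (I.mul_mem_left _ hgI)) rfl
  simpa using I.add_mem this hgI

/-- A flat tuple together with a regular constant has only trivial relations. -/
lemma FlatnessCondition.koszulExact {n : ℕ} {x : Module.Basis (Fin n) ℤ Λ} {q : Fin n → R[Λ]}
    (hq : FlatnessCondition x q) {c : R} (hc : ∀ r, c * r = 0 → r = 0) :
    KoszulExact (consForm (AddMonoidAlgebra.single 0 c) q) := by
  refine koszulExact_consForm _ _ (fun f hf => ?_) fun i f hf => ?_
  · ext l
    have := congrArg (fun g : R[Λ] => g.coeff l) hf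
    simp only [AddMonoidAlgebra.coeff_single_zero_mul] at this
    exact hc _ this
  · obtain ⟨m, hm, hlt⟩ := (hq i).2
    refine mem_of_mul_mem_of_leading (x.coord i).toAddMonoidHom _ (fun g hg t => ?_) hm
      (fun l hl hlm => by simpa using hlt l hl hlm) hf
    -- The constant and the earlier `q j` do not involve x_i, so multiplication by them preserves
    -- the degree in x_i.
    refine restrictSupport_mem_span (fun s hs => ⟨fun l => x.coord i l = t, fun l hl k => ?_⟩) hg
    have hl0 : x.repr l i = 0 := by
      rcases hs with rfl | ⟨j, hj, rfl⟩
      · rw [AddMonoidAlgebra.coeff_single] at hl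
        rw [Finset.mem_singleton.1 (Finsupp.support_single_subset hl)]
        simp
      · exact (hq j).1 l hl i hj
    simp [hl0]

/-- The form with values `q` at `z` is the form with values `q A` at `A⁻¹ z`; the coordinate of the
constant is untouched. -/
lemma GeneralizedFlatnessCondition.koszulExact {n : ℕ} {x : Module.Basis (Fin n) ℤ Λ}
    {q : Fin n → R[Λ]} (hq : GeneralizedFlatnessCondition x q) {c : R}
    (hc : ∀ r, c * r = 0 → r = 0) :
    KoszulExact (consForm (AddMonoidAlgebra.single 0 c) q) := by
  obtain ⟨A, hA⟩ := hq
  have hdet : IsUnit ((A⁻¹ : Matrix.GeneralLinearGroup (Fin n) R[Λ]) :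
      Matrix (Fin n) (Fin n) R[Λ]).det := (Matrix.isUnit_iff_isUnit_det _).1 (A⁻¹).isUnit
  have h1 := (hA.koszulExact hc).comp_equiv ((LinearEquiv.refl R[Λ] R[Λ]).prodCongr
    (Matrix.toLinearEquiv' _ (Matrix.invertibleOfIsUnitDet _ hdet)))
  convert h1 using 1
  refine LinearMap.ext fun z => ?_
  have h2 : ∑ i, z.2 i * q i = ((A⁻¹ : Matrix.GeneralLinearGroup (Fin n) R[Λ]).1.mulVec z.2) ⬝ᵥ
      (Matrix.vecMul q A.1) := by
    rw [dotProduct_comm, ← Matrix.dotProduct_mulVec, Matrix.mulVec_mulVec, ← Units.val_mul,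
      mul_inv_cancel, Units.val_one, Matrix.one_mulVec, dotProduct_comm]
    rfl
  rw [consForm_apply, h2]
  simp [consForm_apply, dotProduct, Matrix.toLinearEquiv']

end Flatness

/-! ### The weight lattice: pairings, the invariant form, and dominant weights -/

namespace RootPairing

section Lattice

variable {ι k M N : Type*} [Field k] [CharZero k] [AddCommGroup M] [Module k M]
  [AddCommGroup N] [Module k N] (P : RootPairing ι k M N)

/-- The integral pairing of weights with a coroot. -/
def intPairing (i : ι) : P.weightLattice →+ ℤ where
  toFun v := (v.2 i).choose
  map_zero' := by
    have h := ((0 : P.weightLattice).2 i).choose_spec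
    have h' : (((0 : P.weightLattice).2 i).choose : k) = 0 := by
      rw [← h]; simp
    exact_mod_cast h'
  map_add' v w := by
    have h' : (((v + w).2 i).choose : k) = ((v.2 i).choose : k) + ((w.2 i).choose : k) := by
      rw [← (v.2 i).choose_spec, ← (w.2 i).choose_spec, ← ((v + w).2 i).choose_spec]; simp
    exact_mod_cast h'

lemma intPairing_cast (i : ι) (v : P.weightLattice) :
    ((P.intPairing i v : ℤ) : k) = P.coroot' i (v : M) :=
  (v.2 i).choose_spec.symm

variable [P.IsCrystallographic]

/-- The action of an element of the Weyl group as an additive map. -/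
def weylAddHom (g : P.weylGroup) : P.weightLattice →+ P.weightLattice where
  toFun v := g • v
  map_zero' := Subtype.ext (smul_zero g)
  map_add' v w := Subtype.ext (smul_add g (v : M) (w : M))

lemma weylAddHom_apply (g : P.weylGroup) (v : P.weightLattice) : P.weylAddHom g v = g • v := rfl

lemma smul_weight_sub (g : P.weylGroup) (v w : P.weightLattice) : g • (v - w) = g • v - g • w :=
  map_sub (P.weylAddHom g) v w

lemma smul_weight_zero (g : P.weylGroup) : g • (0 : P.weightLattice) = 0 :=
  map_zero (P.weylAddHom g)

lemma smul_weight_zsmul (g : P.weylGroup) (z : ℤ) (v : P.weightLattice) :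
    g • (z • v) = z • (g • v) :=
  map_zsmul (P.weylAddHom g) z v

lemma ofIdx_smul_weight (i : ι) (v : P.weightLattice) :
    weylGroup.ofIdx P i • v = v - P.intPairing i v • P.rootWeight i := by
  apply Subtype.ext
  have h : ((weylGroup.ofIdx P i • v : P.weightLattice) : M) = P.reflection i (v : M) := rfl
  rw [h, P.reflection_apply, ← intPairing_cast, Int.cast_smul_eq_zsmul]
  rfl

lemma intPairing_rootWeight_self (i : ι) : P.intPairing i (P.rootWeight i) = 2 := by
  have h : ((P.intPairing i (P.rootWeight i) : ℤ) : k) = 2 := by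
    rw [intPairing_cast]; simp [rootWeight]
  exact_mod_cast h

lemma ofIdx_smul_rootWeight_self (i : ι) :
    weylGroup.ofIdx P i • P.rootWeight i = -P.rootWeight i := by
  rw [ofIdx_smul_weight, intPairing_rootWeight_self, two_smul]; abel

lemma ofIdx_smul_ofIdx_smul (i : ι) (v : P.weightLattice) :
    weylGroup.ofIdx P i • weylGroup.ofIdx P i • v = v := by
  rw [ofIdx_smul_weight P i v, smul_weight_sub, smul_weight_zsmul, ofIdx_smul_rootWeight_self,
    ofIdx_smul_weight]
  simp

lemma smul_rootWeight (g : P.weylGroup) (i : ι) :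
    g • P.rootWeight i = P.rootWeight (P.weylGroupToPerm g i) :=
  Subtype.ext (P.weylGroup_apply_root g i)

lemma weylGroupToPerm_ofIdx (i j : ι) :
    P.weylGroupToPerm (weylGroup.ofIdx P i) j = P.reflectionPerm i j := rfl

lemma intPairing_ofIdx_smul (i j : ι) (v : P.weightLattice) :
    P.intPairing i (weylGroup.ofIdx P j • v) = P.intPairing (P.reflectionPerm j i) v := by
  have h : ((P.intPairing i (weylGroup.ofIdx P j • v) : ℤ) : k) =
      (P.intPairing (P.reflectionPerm j i) v : ℤ) := by
    rw [intPairing_cast, intPairing_cast]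
    exact (P.coroot'_reflection (i := j) (j := i) (v : M))
  exact_mod_cast h

/-! ### The invariant form and its relation to the coroots -/

section Form

variable [Fintype ι]

/-- The canonical invariant form on the weight lattice. -/
def weightForm (v w : P.weightLattice) : ℤ := ∑ i, P.intPairing i v * P.intPairing i w

lemma weightForm_comm (v w : P.weightLattice) : P.weightForm v w = P.weightForm w v :=
  Finset.sum_congr rfl fun _ _ => mul_comm _ _

lemma weightForm_add_right (u v w : P.weightLattice) :
    P.weightForm u (v + w) = P.weightForm u v + P.weightForm u w := by
  simp [weightForm, mul_add, Finset.sum_add_distrib]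

lemma weightForm_neg_right (u v : P.weightLattice) :
    P.weightForm u (-v) = -P.weightForm u v := by
  simp [weightForm]

lemma weightForm_zsmul_right (u v : P.weightLattice) (z : ℤ) :
    P.weightForm u (z • v) = z * P.weightForm u v := by
  simp [weightForm, Finset.mul_sum, mul_left_comm]

lemma weightForm_sub_right (u v w : P.weightLattice) :
    P.weightForm u (v - w) = P.weightForm u v - P.weightForm u w := by
  rw [sub_eq_add_neg, weightForm_add_right, weightForm_neg_right, sub_eq_add_neg]

lemma weightForm_zero_right (u : P.weightLattice) : P.weightForm u 0 = 0 := by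
  simp [weightForm]

lemma weightForm_self_add (v w : P.weightLattice) :
    P.weightForm (v + w) (v + w) =
      P.weightForm v v + 2 * P.weightForm v w + P.weightForm w w := by
  rw [weightForm_add_right, weightForm_comm P (v + w) v, weightForm_comm P (v + w) w,
    weightForm_add_right, weightForm_add_right, weightForm_comm P w v]
  ring

lemma weightForm_self_nonneg (v : P.weightLattice) : 0 ≤ P.weightForm v v :=
  Finset.sum_nonneg fun _ _ => mul_self_nonneg _

lemma intPairing_eq_zero_of_weightForm_self {v : P.weightLattice} (h : P.weightForm v v = 0)
    (i : ι) : P.intPairing i v = 0 :=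
  mul_self_eq_zero.1 ((Finset.sum_eq_zero_iff_of_nonneg fun _ _ => mul_self_nonneg _).1 h i
    (Finset.mem_univ i))

lemma weightForm_rootWeight_pos (i : ι) :
    0 < P.weightForm (P.rootWeight i) (P.rootWeight i) := by
  refine lt_of_le_of_ne (P.weightForm_self_nonneg _) fun h => ?_
  have := P.intPairing_eq_zero_of_weightForm_self h.symm i
  rw [intPairing_rootWeight_self] at this
  omega

lemma weightForm_ofIdx_smul (j : ι) (v w : P.weightLattice) :
    P.weightForm (weylGroup.ofIdx P j • v) (weylGroup.ofIdx P j • w) = P.weightForm v w := by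
  simp only [weightForm, intPairing_ofIdx_smul]
  exact Equiv.sum_comp (P.reflectionPerm j) fun i => P.intPairing i v * P.intPairing i w

lemma weightForm_smul_smul (g : P.weylGroup) (v w : P.weightLattice) :
    P.weightForm (g • v) (g • w) = P.weightForm v w := by
  obtain ⟨g, hg⟩ := g
  induction hg using weylGroup.induction generalizing v w with
  | mem i => exact P.weightForm_ofIdx_smul i v w
  | one => exact congrArg₂ P.weightForm (one_smul P.weylGroup v) (one_smul P.weylGroup w)
  | mul x y hx hy ihx ihy =>
    have h : ∀ u : P.weightLattice, (⟨x * y, mul_mem hx hy⟩ : P.weylGroup) • u =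
      (⟨x, hx⟩ : P.weylGroup) • (⟨y, hy⟩ : P.weylGroup) • u := fun u => mul_smul
        (⟨x, hx⟩ : P.weylGroup) ⟨y, hy⟩ u
    rw [h, h, ihx, ihy]

/-- The form is invariant under the reflection in the root, which negates that root and subtracts a
multiple of it from `v`. -/
lemma two_mul_weightForm_rootWeight (v : P.weightLattice) (i : ι) :
    2 * P.weightForm v (P.rootWeight i) =
      P.intPairing i v * P.weightForm (P.rootWeight i) (P.rootWeight i) := by
  have h := P.weightForm_ofIdx_smul i v (P.rootWeight i)
  rw [ofIdx_smul_rootWeight_self, ofIdx_smul_weight, weightForm_neg_right, weightForm_comm,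
    weightForm_sub_right, weightForm_zsmul_right, weightForm_comm P _ v] at h
  linarith

/-- By the preceding identity the pairing is determined by the invariant form, since roots have
positive norm. -/
lemma intPairing_smul (g : P.weylGroup) (i : ι) (v : P.weightLattice) :
    P.intPairing (P.weylGroupToPerm g i) (g • v) = P.intPairing i v := by
  have h1 := P.two_mul_weightForm_rootWeight (g • v) (P.weylGroupToPerm g i)
  rw [← smul_rootWeight, weightForm_smul_smul, weightForm_smul_smul,
    two_mul_weightForm_rootWeight] at h1
  exact (mul_right_cancel₀ (P.weightForm_rootWeight_pos i).ne' h1).symm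

lemma ofIdx_smul_smul_of_smul_rootWeight {g : P.weylGroup} {i j : ι}
    (h : P.weylGroupToPerm g j = i) (v : P.weightLattice) :
    weylGroup.ofIdx P i • g • v = g • weylGroup.ofIdx P j • v := by
  subst h
  rw [ofIdx_smul_weight, ofIdx_smul_weight, intPairing_smul, smul_weight_sub, smul_weight_zsmul,
    smul_rootWeight]

end Form

end Lattice

/-! ### Dominant weights, sums of simple roots, and fundamental weights -/

namespace Base

variable {ι k M N : Type*} [Field k] [CharZero k] [AddCommGroup M] [Module k M]
  [AddCommGroup N] [Module k N] {P : RootPairing ι k M N} (b : P.Base)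

/-- A weight is dominant if it pairs nonnegatively with all simple coroots. -/
def IsDominant (v : P.weightLattice) : Prop := ∀ i ∈ b.support, 0 ≤ P.intPairing i v

/-- The sums of simple roots. -/
def posCone [P.IsCrystallographic] : AddSubmonoid P.weightLattice :=
  AddSubmonoid.closure (P.rootWeight '' b.support)

variable {b}

lemma isPos_iff_not_of_root_eq_neg {i j : ι} (h : P.root i = -P.root j) :
    b.IsPos i ↔ ¬ b.IsPos j := by
  let := P.indexNeg
  have : i = -j := P.root.injective (by rw [h]; simp)
  rw [this, IsPos.neg_iff_not]

variable [Finite ι] [P.IsCrystallographic]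

lemma IsPos.rootWeight_mem_posCone {i : ι} (hi : b.IsPos i) : P.rootWeight i ∈ b.posCone := by
  refine hi.induction_on_add (p := fun i => P.rootWeight i ∈ b.posCone)
    (fun i hi => AddSubmonoid.subset_closure ⟨i, hi, rfl⟩) fun i j l h hi hj => ?_
  have : P.rootWeight l = P.rootWeight i + P.rootWeight j := Subtype.ext h
  rw [this]
  exact add_mem hi (AddSubmonoid.subset_closure ⟨j, hj, rfl⟩)

lemma neg_rootWeight_mem_posCone {i : ι} (hi : ¬ b.IsPos i) : -P.rootWeight i ∈ b.posCone := by
  have hroot : P.root (P.reflectionPerm i i) = -P.root i := by simp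
  have h := ((isPos_iff_not_of_root_eq_neg hroot).2 hi).rootWeight_mem_posCone
  have : -P.rootWeight i = P.rootWeight (P.reflectionPerm i i) := Subtype.ext hroot.symm
  rwa [this]

section Positivity

variable [Fintype ι]

lemma IsDominant.weightForm_nonneg {v w : P.weightLattice} (hv : b.IsDominant v)
    (hw : w ∈ b.posCone) : 0 ≤ P.weightForm v w := by
  induction hw using AddSubmonoid.closure_induction with
  | mem w hw =>
    obtain ⟨i, hi, rfl⟩ := hw
    have := P.two_mul_weightForm_rootWeight v i
    have := mul_nonneg (hv i hi) (P.weightForm_rootWeight_pos i).le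
    omega
  | zero => rw [weightForm_zero_right]
  | add x y _ _ hx hy => rw [weightForm_add_right]; exact add_nonneg hx hy

lemma IsDominant.intPairing_nonneg {v : P.weightLattice} (hv : b.IsDominant v) {i : ι}
    (hi : b.IsPos i) : 0 ≤ P.intPairing i v := by
  have h1 := hv.weightForm_nonneg hi.rootWeight_mem_posCone
  have h2 := P.two_mul_weightForm_rootWeight v i
  refine nonneg_of_mul_nonneg_left (b := P.weightForm (P.rootWeight i) (P.rootWeight i)) ?_
    (P.weightForm_rootWeight_pos i)
  omega

lemma IsDominant.intPairing_nonpos {v : P.weightLattice} (hv : b.IsDominant v) {i : ι}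
    (hi : ¬ b.IsPos i) : P.intPairing i v ≤ 0 := by
  have h1 := hv.weightForm_nonneg (neg_rootWeight_mem_posCone hi)
  rw [weightForm_neg_right] at h1
  have h2 := P.two_mul_weightForm_rootWeight v i
  by_contra! h
  have := mul_pos h (P.weightForm_rootWeight_pos i)
  omega

lemma IsDominant.weightForm_nonneg' {v w : P.weightLattice} (hv : b.IsDominant v)
    (hw : b.IsDominant w) : 0 ≤ P.weightForm v w := by
  refine Finset.sum_nonneg fun i _ => ?_
  by_cases hi : b.IsPos i
  · exact mul_nonneg (hv.intPairing_nonneg hi) (hw.intPairing_nonneg hi)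
  · exact mul_nonneg_of_nonpos_of_nonpos (hv.intPairing_nonpos hi) (hw.intPairing_nonpos hi)

end Positivity

section Fundamental

variable [P.IsRootSystem]

open Classical in
lemma intPairing_fundamentalWeight (i j : b.support) :
    P.intPairing j (b.fundamentalWeight i) = if j = i then 1 else 0 := by
  have h : ((P.intPairing j (b.fundamentalWeight i) : ℤ) : k) = if j = i then 1 else 0 := by
    rw [intPairing_cast]; exact b.coroot'_fundamentalVector i j
  split_ifs with hij
  · rw [if_pos hij] at h; exact_mod_cast h
  · rw [if_neg hij] at h; exact_mod_cast h

/-- The simple coroots form a basis of the dual space. Definiteness of the invariant form rests on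
this. -/
lemma eq_zero_of_intPairing_eq_zero {v : P.weightLattice}
    (h : ∀ i ∈ b.support, P.intPairing i v = 0) : v = 0 := by
  apply Subtype.ext
  have h1 : P.toPerfPair (v : M) = 0 := by
    refine b.toCoweightBasis.ext fun i => ?_
    have h2 : P.toPerfPair (v : M) (P.coroot i) = ((P.intPairing i v : ℤ) : k) :=
      (P.intPairing_cast i v).symm
    rw [toCoweightBasis_apply, h2, h i i.2]
    simp
  exact (LinearEquiv.map_eq_zero_iff P.toPerfPair).1 h1

lemma isDominant_fundamentalWeight (i : b.support) : b.IsDominant (b.fundamentalWeight i) := by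
  classical
  intro j hj
  have := intPairing_fundamentalWeight i ⟨j, hj⟩
  simp only at this
  rw [this]
  split_ifs <;> simp

lemma fundamentalWeight_ne_zero (i : b.support) : b.fundamentalWeight i ≠ 0 := by
  classical
  intro h
  have := intPairing_fundamentalWeight i i
  rw [h] at this
  simp at this

lemma IsDominant.exists_eq_add {v : P.weightLattice} (hv : b.IsDominant v) (hv0 : v ≠ 0) :
    ∃ (i : b.support) (w : P.weightLattice), b.IsDominant w ∧ v = w + b.fundamentalWeight i := by
  classical
  have : ∃ i ∈ b.support, P.intPairing i v ≠ 0 := by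
    by_contra! h
    exact hv0 (eq_zero_of_intPairing_eq_zero h)
  obtain ⟨i, hi, hne⟩ := this
  refine ⟨⟨i, hi⟩, v - b.fundamentalWeight ⟨i, hi⟩, fun j hj => ?_, by abel⟩
  have h1 := intPairing_fundamentalWeight (b := b) ⟨i, hi⟩ ⟨j, hj⟩
  have h2 := hv j hj
  simp only [Subtype.mk.injEq] at h1
  rw [map_sub, h1]
  split_ifs with hij
  · subst hij; omega
  · omega

/-- The sum of the fundamental weights has this property. Its form with every simple root is
positive, so it acts as a height function. -/
lemma exists_intPairing_eq_one (b : P.Base) :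
    ∃ v : P.weightLattice, ∀ i ∈ b.support, P.intPairing i v = 1 := by
  classical
  refine ⟨∑ i : b.support, b.fundamentalWeight i, fun j hj => ?_⟩
  rw [map_sum]
  have : ∀ i : b.support, P.intPairing j (b.fundamentalWeight i) =
    if (⟨j, hj⟩ : b.support) = i then 1 else 0 := fun i => intPairing_fundamentalWeight i ⟨j, hj⟩
  simp [this]

lemma weightForm_self_pos [Fintype ι] (b : P.Base) {v : P.weightLattice} (hv : v ≠ 0) :
    0 < P.weightForm v v := by
  refine lt_of_le_of_ne (P.weightForm_self_nonneg v) fun h => hv ?_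
  exact eq_zero_of_intPairing_eq_zero (b := b) fun i _ =>
    P.intPairing_eq_zero_of_weightForm_self h.symm i

end Fundamental

end Base

end RootPairing

/-! ### Words in the simple reflections and dominant representatives -/

namespace RootPairing.Base

variable {ι k M N : Type*} [Field k] [CharZero k] [AddCommGroup M] [Module k M]
  [AddCommGroup N] [Module k N] {P : RootPairing ι k M N} {b : P.Base}

/-- The product of the simple reflections with the given indices. -/
def wordProd (L : List b.support) : P.weylGroup := (L.map fun i => weylGroup.ofIdx P i).prod

lemma wordProd_nil : wordProd ([] : List b.support) = 1 := rfl

lemma wordProd_cons (i : b.support) (L : List b.support) :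
    wordProd (i :: L) = weylGroup.ofIdx P i * wordProd L := by
  simp [wordProd]

lemma wordProd_append (L L' : List b.support) :
    wordProd (L ++ L') = wordProd L * wordProd L' := by
  simp [wordProd]

variable [Finite ι] [P.IsCrystallographic] [P.IsReduced]

/-- The exchange property: if a word in the simple reflections maps a simple root to a negative
root, then its product with the corresponding simple reflection acts as a shorter word. -/
lemma exists_wordProd_of_not_isPos [Fintype ι] (L : List b.support) (j : b.support)
    (h : ¬ b.IsPos (P.weylGroupToPerm (wordProd L) j)) :
    ∃ L' : List b.support, L'.length < L.length ∧
      ∀ v : P.weightLattice, wordProd L' • v = wordProd L • weylGroup.ofIdx P j • v := by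
  induction L with
  | nil =>
    refine absurd ?_ h
    rw [wordProd_nil, map_one]
    exact isPos_of_mem_support j.2
  | cons i L ih =>
    by_cases hj : b.IsPos (P.weylGroupToPerm (wordProd L) j)
    -- A simple reflection keeps every positive root positive except its own simple root.
    · have hi : P.weylGroupToPerm (wordProd L) j = i := by
        by_contra hne
        refine h ?_
        rw [wordProd_cons, map_mul, Equiv.Perm.mul_apply, weylGroupToPerm_ofIdx]
        exact hj.reflectionPerm i.2 hne
      refine ⟨L, by simp, fun v => ?_⟩
      rw [wordProd_cons, mul_smul, ofIdx_smul_smul_of_smul_rootWeight P hi,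
        ofIdx_smul_ofIdx_smul]
    · obtain ⟨L', hlen, hL'⟩ := ih hj
      refine ⟨i :: L', by simpa using hlen, fun v => ?_⟩
      rw [wordProd_cons, wordProd_cons, mul_smul, mul_smul, hL']

lemma exists_wordProd_ofIdx (b : P.Base) (i : ι) :
    ∃ L : List b.support, ∀ v : P.weightLattice, weylGroup.ofIdx P i • v = wordProd L • v := by
  refine b.induction_reflect i (p := fun i => ∃ L : List b.support,
      ∀ v : P.weightLattice, weylGroup.ofIdx P i • v = wordProd L • v) (fun i ⟨L, hL⟩ => ⟨L, fun v => ?_⟩)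
    (fun i hi => ⟨[⟨i, hi⟩], fun v => by simp [wordProd]⟩) fun i j ⟨L, hL⟩ hj =>
      ⟨⟨j, hj⟩ :: (L ++ [⟨j, hj⟩]), fun v => ?_⟩
  · rw [← hL]
    apply Subtype.ext
    change P.reflection (P.reflectionPerm i i) (v : M) = P.reflection i (v : M)
    rw [reflection_reflectionPerm]
    simp
  · rw [wordProd_cons, wordProd_append, mul_smul, mul_smul, ← hL]
    apply Subtype.ext
    have h1 : wordProd [(⟨j, hj⟩ : b.support)] = weylGroup.ofIdx P j := by simp [wordProd]
    rw [h1]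
    change P.reflection (P.reflectionPerm j i) (v : M) =
      P.reflection j (P.reflection i (P.reflection j (v : M)))
    rw [reflection_reflectionPerm]
    rfl

lemma exists_wordProd (b : P.Base) (g : P.weylGroup) :
    ∃ L : List b.support, ∀ v : P.weightLattice, g • v = wordProd L • v := by
  obtain ⟨g, hg⟩ := g
  induction hg using weylGroup.induction with
  | mem i => exact b.exists_wordProd_ofIdx i
  | one => exact ⟨[], fun v => rfl⟩
  | mul x y hx hy ihx ihy =>
    obtain ⟨L, hL⟩ := ihx
    obtain ⟨L', hL'⟩ := ihy
    refine ⟨L ++ L', fun v => ?_⟩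
    rw [wordProd_append, mul_smul, ← hL', ← hL]
    exact mul_smul (⟨x, hx⟩ : P.weylGroup) ⟨y, hy⟩ v

/-- The word can be shortened without changing its effect on `v`. If it makes a simple root
negative, dominance at both ends forces the corresponding reflection to fix `v`. If it keeps all
simple roots positive, a nonempty word is not reduced. -/
lemma IsDominant.wordProd_smul_eq [Fintype ι] {v : P.weightLattice} (hv : b.IsDominant v)
    (L : List b.support) (hL : b.IsDominant (wordProd L • v)) : wordProd L • v = v := by
  induction hn : L.length using Nat.strong_induction_on generalizing L with
  | _ n ih =>
  subst hn
  by_cases h : ∃ j : b.support, ¬ b.IsPos (P.weylGroupToPerm (wordProd L) j)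
  · obtain ⟨j, hj⟩ := h
    obtain ⟨L', hlen, hL'⟩ := exists_wordProd_of_not_isPos L j hj
    have h0 : P.intPairing j v = 0 := by
      refine le_antisymm ?_ (hv j j.2)
      rw [← P.intPairing_smul (wordProd L)]
      exact hL.intPairing_nonpos hj
    have h1 : wordProd L' • v = wordProd L • v := by
      rw [hL', ofIdx_smul_weight, h0, zero_smul, sub_zero]
    rw [← h1] at hL ⊢
    exact ih _ hlen L' hL rfl
  · push Not at h
    rcases List.eq_nil_or_concat L with rfl | ⟨L₀, j, rfl⟩
    · rw [wordProd_nil, one_smul]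
    · have hj := h j
      have hword : wordProd (L₀ ++ [j]) = wordProd L₀ * weylGroup.ofIdx P j := by
        rw [wordProd_append]; simp [wordProd]
      rw [List.concat_eq_append] at *
      -- The last letter negates its own simple root, so the word without that letter has the
      -- opposite effect on it.
      have hneg : ¬ b.IsPos (P.weylGroupToPerm (wordProd L₀) j) := by
        refine (isPos_iff_not_of_root_eq_neg ?_).1 hj
        have h1 := P.smul_rootWeight (wordProd (L₀ ++ [j])) j
        rw [hword, mul_smul, ofIdx_smul_rootWeight_self, ← weylAddHom_apply, map_neg,
          weylAddHom_apply, smul_rootWeight] at h1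
        rw [hword]
        exact (congrArg Subtype.val h1).symm
      obtain ⟨L', hlen, hL'⟩ := exists_wordProd_of_not_isPos L₀ j hneg
      have h1 : wordProd L' • v = wordProd (L₀ ++ [j]) • v := by rw [hL', hword, mul_smul]
      rw [← h1] at hL ⊢
      exact ih _ (by simp only [List.length_append, List.length_singleton]; omega) L' hL rfl

/-- The dominant element of an orbit is unique. -/
lemma IsDominant.smul_eq [Fintype ι] {v : P.weightLattice} (hv : b.IsDominant v)
    {g : P.weylGroup} (hg : b.IsDominant (g • v)) : g • v = v := by
  obtain ⟨L, hL⟩ := b.exists_wordProd g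
  rw [hL] at hg ⊢
  exact hv.wordProd_smul_eq L hg

variable [P.IsRootSystem]

/-- Among the conjugates of `v` that exceed a given one there is a dominant one. -/
lemma exists_isDominant_smul [Fintype ι] (b : P.Base) (v : P.weightLattice) (g : P.weylGroup) :
    ∃ h : P.weylGroup, b.IsDominant (h • v) ∧ h • v - g • v ∈ b.posCone := by
  obtain ⟨δ, hδ⟩ := exists_intPairing_eq_one b
  have : Nonempty {h : P.weylGroup // h • v - g • v ∈ b.posCone} :=
    ⟨⟨g, by rw [sub_self]; exact zero_mem _⟩⟩
  -- A conjugate of maximal height is dominant: a simple reflection at a negative pairing would add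
  -- a positive multiple of a simple root.
  obtain ⟨⟨h, hh⟩, hmax⟩ := Finite.exists_max
    fun h : {h : P.weylGroup // h • v - g • v ∈ b.posCone} => P.weightForm δ (h.1 • v)
  refine ⟨h, fun i hi => ?_, hh⟩
  by_contra! hneg
  have h1 : (weylGroup.ofIdx P i * h) • v = h • v + (-P.intPairing i (h • v)) • P.rootWeight i := by
    rw [mul_smul, ofIdx_smul_weight, neg_smul, sub_eq_add_neg]
  have h2 : (weylGroup.ofIdx P i * h) • v - g • v ∈ b.posCone := by
    rw [h1, add_sub_right_comm]
    refine add_mem hh ?_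
    have h3 : (-P.intPairing i (h • v)) = ((-P.intPairing i (h • v)).toNat : ℤ) := by omega
    rw [h3, natCast_zsmul]
    have h7 : P.rootWeight i ∈ b.posCone := AddSubmonoid.subset_closure ⟨i, hi, rfl⟩
    exact nsmul_mem h7 _
  have h4 := hmax ⟨_, h2⟩
  simp only at h4
  rw [h1, weightForm_add_right, weightForm_zsmul_right] at h4
  have h5 := P.two_mul_weightForm_rootWeight δ i
  rw [hδ i hi, one_mul] at h5
  have h6 := P.weightForm_rootWeight_pos i
  nlinarith

/-- Some dominant conjugate lies above `g • v`, and by uniqueness it is `v`. -/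
lemma IsDominant.sub_smul_mem_posCone [Fintype ι] {v : P.weightLattice} (hv : b.IsDominant v)
    (g : P.weylGroup) : v - g • v ∈ b.posCone := by
  obtain ⟨h, hh, hmem⟩ := b.exists_isDominant_smul v g
  rwa [hv.smul_eq hh] at hmem

lemma eq_zero_of_add_eq_zero_of_mem_posCone [Fintype ι] {v w : P.weightLattice}
    (hv : v ∈ b.posCone) (hw : w ∈ b.posCone) (h : v + w = 0) : v = 0 := by
  obtain ⟨δ, hδ⟩ := exists_intPairing_eq_one b
  have key : ∀ u ∈ b.posCone, 0 ≤ P.weightForm δ u ∧ (P.weightForm δ u = 0 → u = 0) := by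
    intro u hu
    induction hu using AddSubmonoid.closure_induction with
    | mem u hu =>
      obtain ⟨i, hi, rfl⟩ := hu
      have h5 := P.two_mul_weightForm_rootWeight δ i
      rw [hδ i hi, one_mul] at h5
      have h6 := P.weightForm_rootWeight_pos i
      exact ⟨by omega, fun _ => by omega⟩
    | zero => exact ⟨(P.weightForm_zero_right δ).ge, fun _ => rfl⟩
    | add x y _ _ hx hy =>
      rw [weightForm_add_right]
      refine ⟨add_nonneg hx.1 hy.1, fun h => ?_⟩
      rw [hx.2 (by omega), hy.2 (by omega), add_zero]
  have h1 := congrArg (P.weightForm δ) h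
  rw [weightForm_add_right, weightForm_zero_right] at h1
  have := (key v hv).1
  have := (key w hw).1
  exact (key v hv).2 (by omega)

end RootPairing.Base

/-! ### Orbit sums and invariant elements of the group ring -/

namespace RootPairing

variable {ι k M N : Type*} [Finite ι] [Field k] [CharZero k] [AddCommGroup M] [Module k M]
  [AddCommGroup N] [Module k N] (P : RootPairing ι k M N) [P.IsRootSystem] [P.IsCrystallographic]

/-- The subring of Weyl group invariant elements of the group ring of the weight lattice. -/
def invariantSubring : Subring ℤ[P.weightLattice] :=
  ⨅ g : P.weylGroup, (AddMonoidAlgebra.mapDomainRingHom ℤ (P.weylAddHom g)).eqLocus (RingHom.id _)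

lemma mem_invariantSubring {f : ℤ[P.weightLattice]} :
    f ∈ P.invariantSubring ↔
      ∀ g : P.weylGroup, AddMonoidAlgebra.mapDomain (g • ·) f = f := by
  simp only [invariantSubring, Subring.mem_iInf]
  rfl

lemma coeff_smul_of_mem_invariantSubring {f : ℤ[P.weightLattice]} (hf : f ∈ P.invariantSubring)
    (g : P.weylGroup) (m : P.weightLattice) : f.coeff (g • m) = f.coeff m := by
  have h1 := congrArg (fun f => f.coeff (g • m)) ((P.mem_invariantSubring.1 hf) g)
  rw [← h1]
  exact Finsupp.mapDomain_apply (MulAction.injective g) f.coeff m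

open Classical in
lemma coeff_orbitSum (l m : P.weightLattice) :
    (P.orbitSum l).coeff m = if ∃ g : P.weylGroup, g • l = m then 1 else 0 := by
  simp [orbitSum, Finsupp.single_apply]

lemma orbitSum_mem_invariantSubring (l : P.weightLattice) : P.orbitSum l ∈ P.invariantSubring := by
  classical
  rw [mem_invariantSubring]
  intro g
  ext m
  obtain ⟨m, rfl⟩ := MulAction.surjective g m
  have h1 : (AddMonoidAlgebra.mapDomain (g • ·) (P.orbitSum l)).coeff (g • m) =
      (P.orbitSum l).coeff m := Finsupp.mapDomain_apply (MulAction.injective g) _ m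
  rw [h1, coeff_orbitSum, coeff_orbitSum]
  refine if_congr ⟨fun ⟨h, hh⟩ => ⟨g * h, by rw [mul_smul, hh]⟩, fun ⟨h, hh⟩ => ⟨g⁻¹ * h, ?_⟩⟩
    rfl rfl
  rw [mul_smul, hh, inv_smul_smul]

lemma orbitCard_eq_card (l : P.weightLattice) :
    P.orbitCard l = (Set.finite_range fun g : P.weylGroup => g • l).toFinset.card :=
  Set.ncard_eq_toFinset_card _ (Set.finite_range _)

lemma orbitCard_pos (l : P.weightLattice) : 0 < P.orbitCard l := by
  rw [orbitCard_eq_card, Finset.card_pos]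
  exact ⟨l, (Set.Finite.mem_toFinset _).2 ⟨1, one_smul _ l⟩⟩

lemma augmentation_single (l : P.weightLattice) (z : ℤ) :
    P.augmentation (AddMonoidAlgebra.single l z) = z := by
  simp [augmentation, AddMonoidAlgebra.lift_single]

lemma augmentation_orbitSum (l : P.weightLattice) :
    P.augmentation (P.orbitSum l) = P.orbitCard l := by
  rw [orbitSum, map_sum, orbitCard_eq_card]
  simp [augmentation_single]

lemma augmentation_augOrbitSum (l : P.weightLattice) :
    P.augmentation (P.augOrbitSum l) = 0 := by
  rw [augOrbitSum, map_sub, augmentation_orbitSum, map_natCast]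
  simp

lemma augOrbitSum_mem_invariantIdeal (l : P.weightLattice) :
    P.augOrbitSum l ∈ P.invariantIdeal := by
  refine Ideal.subset_span ⟨P.mem_invariantSubring.1 ?_, P.augmentation_augOrbitSum l⟩
  exact sub_mem (P.orbitSum_mem_invariantSubring l) (natCast_mem _ _)

lemma orbitSum_zero : P.orbitSum 0 = 1 := by
  classical
  ext m
  rw [coeff_orbitSum, AddMonoidAlgebra.one_def, AddMonoidAlgebra.coeff_single,
    Finsupp.single_apply]
  simp [smul_weight_zero]

namespace Base

variable {P} {b : P.Base} [P.IsReduced]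

/-- Invariant elements are integral combinations of orbit sums of dominant weights in their
support. -/
lemma mem_of_orbitSum_mem [Fintype ι] (A : AddSubgroup ℤ[P.weightLattice]) {f : ℤ[P.weightLattice]}
    (hf : f ∈ P.invariantSubring)
    (hA : ∀ v ∈ f.coeff.support, b.IsDominant v → P.orbitSum v ∈ A) : f ∈ A := by
  classical
  induction hk : f.coeff.support.card using Nat.strong_induction_on generalizing f with
  | _ n ih =>
  by_cases hf0 : f = 0
  · rw [hf0]; exact zero_mem _
  obtain ⟨w, hw⟩ : f.coeff.support.Nonempty := by
    rwa [Finsupp.support_nonempty_iff, Ne, AddMonoidAlgebra.coeff_eq_zero]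
  obtain ⟨h, hdom, -⟩ := b.exists_isDominant_smul w 1
  have hv : h • w ∈ f.coeff.support := by
    rw [Finsupp.mem_support_iff, P.coeff_smul_of_mem_invariantSubring hf]
    exact Finsupp.mem_support_iff.1 hw
  set v := h • w
  have hvA := hA v hv hdom
  set f' := f - f.coeff v • P.orbitSum v with hf'
  -- An invariant `f` is constant on the orbit of `v`, so the subtraction clears exactly that orbit.
  have hcoeff : ∀ m, f'.coeff m = if ∃ g : P.weylGroup, g • v = m then 0 else f.coeff m := by
    intro m
    rw [hf', AddMonoidAlgebra.coeff_sub, Finsupp.sub_apply, AddMonoidAlgebra.coeff_smul,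
      Finsupp.smul_apply, coeff_orbitSum]
    split_ifs with hm
    · obtain ⟨g, rfl⟩ := hm
      rw [P.coeff_smul_of_mem_invariantSubring hf]; simp
    · simp
  have hsub : f'.coeff.support ⊆ f.coeff.support := by
    intro m hm
    rw [Finsupp.mem_support_iff, hcoeff] at hm
    rw [Finsupp.mem_support_iff]
    split_ifs at hm
    · exact absurd rfl hm
    · exact hm
  have hlt : f'.coeff.support.card < n := by
    rw [← hk]
    refine Finset.card_lt_card ((Finset.ssubset_iff_of_subset hsub).2 ⟨v, hv, ?_⟩)
    rw [Finsupp.notMem_support_iff, hcoeff, if_pos ⟨1, one_smul _ v⟩]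
  have hfA : f' ∈ A := ih _ hlt
    (sub_mem hf (zsmul_mem (P.orbitSum_mem_invariantSubring v) _))
    (fun m hm => hA m (hsub hm)) rfl
  have := add_mem hfA (zsmul_mem hvA (f.coeff v))
  rwa [hf', sub_add_cancel] at this

lemma sub_mem_posCone_of_coeff_mul_ne_zero [Fintype ι] {v w m : P.weightLattice}
    (hv : b.IsDominant v) (hw : b.IsDominant w)
    (hm : (P.orbitSum v * P.orbitSum w).coeff m ≠ 0) : v + w - m ∈ b.posCone := by
  classical
  rw [AddMonoidAlgebra.coeff_mul_apply_left, Finsupp.sum] at hm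
  obtain ⟨u, hu, hne⟩ := Finset.exists_ne_zero_of_sum_ne_zero hm
  rw [Finsupp.mem_support_iff, coeff_orbitSum] at hu
  have hu' := right_ne_zero_of_mul hne
  rw [coeff_orbitSum] at hu'
  obtain ⟨g, rfl⟩ : ∃ g : P.weylGroup, g • v = u := by by_contra h; simp [h] at hu
  obtain ⟨h, hh⟩ : ∃ h : P.weylGroup, h • w = -(g • v) + m := by by_contra h; simp [h] at hu'
  have h1 := add_mem (hv.sub_smul_mem_posCone g) (hw.sub_smul_mem_posCone h)
  rw [hh] at h1
  convert h1 using 1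
  abel

/-- Conjugates of `v` and `w` lie below `v` and `w`, so they can sum to `v + w` only if both are
unmoved. -/
lemma coeff_mul_orbitSum_add [Fintype ι] {v w : P.weightLattice}
    (hv : b.IsDominant v) (hw : b.IsDominant w) :
    (P.orbitSum v * P.orbitSum w).coeff (v + w) = 1 := by
  classical
  rw [AddMonoidAlgebra.coeff_mul_apply_left, Finsupp.sum, Finset.sum_eq_single v]
  · rw [coeff_orbitSum, coeff_orbitSum, if_pos ⟨1, one_smul _ v⟩,
      if_pos ⟨1, by rw [one_smul]; abel⟩, one_mul]
  · intro u hu hne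
    rw [Finsupp.mem_support_iff, coeff_orbitSum] at hu
    obtain ⟨g, rfl⟩ : ∃ g : P.weylGroup, g • v = u := by by_contra h; simp [h] at hu
    rw [P.coeff_orbitSum w, if_neg, mul_zero]
    rintro ⟨h, hh⟩
    refine hne ?_
    have h0 : v - g • v = 0 := eq_zero_of_add_eq_zero_of_mem_posCone
      (hv.sub_smul_mem_posCone g) (hw.sub_smul_mem_posCone h) (by rw [hh]; abel)
    exact (sub_eq_zero.1 h0).symm
  · intro h
    rw [Finsupp.notMem_support_iff] at h
    rw [h, zero_mul]

/-- The orbit sums of the fundamental weights generate the ring of invariants. -/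
lemma orbitSum_mem_of_fundamental [Fintype ι] (A : Subring ℤ[P.weightLattice])
    (hA : ∀ i, P.orbitSum (b.fundamentalWeight i) ∈ A) {v : P.weightLattice}
    (hv : b.IsDominant v) : P.orbitSum v ∈ A := by
  classical
  induction hn : (P.weightForm v v).toNat using Nat.strong_induction_on generalizing v with
  | _ n ih =>
  have hlt : ∀ u, b.IsDominant u → P.weightForm u u < P.weightForm v v → P.orbitSum u ∈ A := by
    intro u hu hlt
    have := P.weightForm_self_nonneg u
    exact ih _ (by omega) hu rfl
  by_cases hv0 : v = 0
  · rw [hv0, orbitSum_zero]; exact one_mem A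
  obtain ⟨i, w, hw, rfl⟩ := hv.exists_eq_add hv0
  have hω := isDominant_fundamentalWeight i
  set ω := b.fundamentalWeight i
  have hwA : P.orbitSum w ∈ A := by
    refine hlt w hw ?_
    have h1 := hw.weightForm_nonneg' hω
    have h2 : 0 < P.weightForm ω ω := weightForm_self_pos b (fundamentalWeight_ne_zero i)
    rw [weightForm_self_add]
    omega
  have hprod := mul_mem hwA (hA i)
  have hinv : P.orbitSum w * P.orbitSum ω - P.orbitSum (w + ω) ∈ P.invariantSubring :=
    sub_mem (mul_mem (P.orbitSum_mem_invariantSubring w) (P.orbitSum_mem_invariantSubring ω))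
      (P.orbitSum_mem_invariantSubring _)
  -- Once the leading orbit sum is removed, every dominant `u` in the support lies strictly below `w
  -- + ω`.
  have hmem := mem_of_orbitSum_mem (b := b) A.toAddSubgroup hinv fun u hu hdom => by
    rw [Finsupp.mem_support_iff, AddMonoidAlgebra.coeff_sub, Finsupp.sub_apply] at hu
    have hne : w + ω - u ≠ 0 := by
      intro h
      rw [← sub_eq_zero.1 h, coeff_mul_orbitSum_add hw hω, coeff_orbitSum,
        if_pos ⟨1, one_smul _ _⟩] at hu
      exact hu (sub_self _)
    have hcone : w + ω - u ∈ b.posCone := by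
      by_cases h : (P.orbitSum w * P.orbitSum ω).coeff u = 0
      · rw [h, coeff_orbitSum] at hu
        obtain ⟨g, rfl⟩ : ∃ g : P.weylGroup, g • (w + ω) = u := by by_contra h; simp [h] at hu
        exact hv.sub_smul_mem_posCone g
      · exact sub_mem_posCone_of_coeff_mul_ne_zero hw hω h
    refine hlt u hdom ?_
    -- The difference is a nonzero sum of simple roots and pairs nonnegatively with the dominant
    -- `u`, so `u` has smaller norm.
    have h1 := P.weightForm_self_add u (w + ω - u)
    rw [add_sub_cancel] at h1
    have h2 := hdom.weightForm_nonneg hcone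
    have h3 := weightForm_self_pos b hne
    omega
  have := sub_mem hprod hmem
  rwa [sub_sub_cancel] at this

/-- The augmented orbit sums of the fundamental weights generate the ideal spanned by the
invariants of augmentation zero. -/
theorem invariantIdeal_eq_span (b : P.Base) : P.invariantIdeal =
    Ideal.span (Set.range fun i => P.augOrbitSum (b.fundamentalWeight i)) := by
  have := Fintype.ofFinite ι
  set I := Ideal.span (Set.range fun i => P.augOrbitSum (b.fundamentalWeight i))
  refine le_antisymm (Ideal.span_le.2 ?_) (Ideal.span_le.2 ?_)
  · rintro f ⟨hf, haug⟩
    -- The elements congruent to their augmentation modulo `I` form a subring; it contains the orbit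
    -- sums of the fundamental weights, hence all invariants.
    let A : Subring ℤ[P.weightLattice] := (Ideal.Quotient.mk I).eqLocus
      ((Ideal.Quotient.mk I).comp ((Int.castRingHom _).comp (P.augmentation : _ →+* ℤ)))
    have hA : ∀ i, P.orbitSum (b.fundamentalWeight i) ∈ A := by
      intro i
      change Ideal.Quotient.mk I _ = Ideal.Quotient.mk I (((P.augmentation _ : ℤ) : ℤ[P.weightLattice]))
      rw [Ideal.Quotient.eq, augmentation_orbitSum]
      exact Ideal.subset_span ⟨i, by simp [augOrbitSum]⟩
    have hfA : f ∈ A := mem_of_orbitSum_mem (b := b) A.toAddSubgroup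
      (P.mem_invariantSubring.2 hf) fun v _ hv => orbitSum_mem_of_fundamental A hA hv
    have h1 : Ideal.Quotient.mk I f =
      Ideal.Quotient.mk I (((P.augmentation f : ℤ) : ℤ[P.weightLattice])) := hfA
    rw [haug, Ideal.Quotient.eq] at h1
    simpa using h1
  · rintro _ ⟨i, rfl⟩
    exact P.augOrbitSum_mem_invariantIdeal _

end Base

end RootPairing

/-! ### Even elements of an ideal -/

section Koszul

variable {A : Type*} [CommRing A] {n : ℕ} {c Y : A} {q t v : Fin n → A}

/-- If `c`, `q_1`, …, `q_n` have only trivial relations, then so have `c` and `Y` modulo the ideal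
generated by all `q_i - t_i (Y - c)`, provided that `Y - c` is a combination of the `q_i`. -/
lemma exists_sub_mul_mem_of_koszulExact (h : KoszulExact (consForm c q))
    (hv : ∑ i, v i * q i = Y - c) (ht : ∑ i, t i * v i = 1) {x y : A}
    (hxy : Y * x - c * y ∈ Ideal.span (Set.range fun i => q i - t i * (Y - c))) :
    ∃ m, x - m * c ∈ Ideal.span (Set.range fun i => q i - t i * (Y - c)) ∧
      y - m * Y ∈ Ideal.span (Set.range fun i => q i - t i * (Y - c)) := by
  set K := Ideal.span (Set.range fun i => q i - t i * (Y - c)) with hK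
  let u : A × (Fin n → A) →ₗ[A] A :=
    (Fintype.linearCombination A t).comp (LinearMap.snd A A (Fin n → A))
  have hu : ∀ z, u z = ∑ i, z.2 i * t i := fun z => by simp [u, Fintype.linearCombination_apply]
  -- Modulo `K` each `q i` becomes `t i * (Y - c)`, so `u z` and `z.1 - u z` are the coefficients of
  -- `Y` and `c`.
  have hform : ∀ z, consForm c q z - (u z * Y + (z.1 - u z) * c) ∈ K := by
    intro z
    have : consForm c q z - (u z * Y + (z.1 - u z) * c) =
        ∑ i, z.2 i * (q i - t i * (Y - c)) := by
      simp only [mul_sub, Finset.sum_sub_distrib, consForm_apply, hu, ← mul_assoc, Finset.sum_mul,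
        sub_mul]
      ring
    rw [this]
    exact sum_mem fun i _ => K.mul_mem_left _ (Ideal.subset_span ⟨i, rfl⟩)
  -- The `i`-th generator of `K` is the value at the `i`-th unit vector minus `t i • v`; there `u`
  -- vanishes because `∑ t i * v i = 1`.
  have hlift : ∀ g ∈ K, ∃ z : A × (Fin n → A), z.1 = 0 ∧ u z = 0 ∧ consForm c q z = g := by
    intro g hg
    induction hg using Submodule.span_induction with
    | mem g hg =>
      obtain ⟨i, rfl⟩ := hg
      refine ⟨(0, Pi.single i 1 - t i • v), rfl, ?_, ?_⟩
      · have h1 : ∑ j, v j * t j = 1 := by rw [← ht]; exact Finset.sum_congr rfl fun j _ => mul_comm _ _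
        simp [hu, sub_mul, Finset.sum_sub_distrib, Pi.single_apply, mul_assoc, ← Finset.mul_sum, h1]
      · simp [consForm_apply, sub_mul, Finset.sum_sub_distrib, Pi.single_apply, mul_assoc,
          ← Finset.mul_sum, hv]
    | zero => exact ⟨0, rfl, map_zero u, map_zero _⟩
    | add g g' _ _ hg hg' =>
      obtain ⟨z, hz1, hz2, rfl⟩ := hg
      obtain ⟨z', hz1', hz2', rfl⟩ := hg'
      exact ⟨z + z', by simp [hz1, hz1'], by simp [hz2, hz2'], map_add _ _ _⟩
    | smul r g _ hg =>
      obtain ⟨z, hz1, hz2, rfl⟩ := hg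
      exact ⟨r • z, by simp [hz1], by simp [hz2], map_smul _ _ _⟩
  have hrel : ∀ z ∈ LinearMap.ker (consForm c q),
      ∃ m, u z - m * c ∈ K ∧ (z.1 - u z) + m * Y ∈ K := by
    intro z hz
    have hz' := h hz
    clear hz
    induction hz' using Submodule.span_induction with
    | mem z hz =>
      obtain ⟨⟨z₁, z₂⟩, rfl⟩ := hz
      have h1 := hform z₁
      have h2 := hform z₂
      -- For a trivial relation, `m` is the determinant, up to sign, of the coefficients of `Y` and
      -- `c` in the two values.
      refine ⟨(z₁.1 - u z₁) * u z₂ - (z₂.1 - u z₂) * u z₁, ?_, ?_⟩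
      · convert K.sub_mem (K.mul_mem_left (u z₂) h1) (K.mul_mem_left (u z₁) h2) using 1
        simp only [map_sub, map_smul, smul_eq_mul]
        ring
      · convert K.sub_mem (K.mul_mem_left (z₂.1 - u z₂) h1) (K.mul_mem_left (z₁.1 - u z₁) h2)
          using 1
        simp only [map_sub, map_smul, smul_eq_mul, Prod.fst_sub, Prod.smul_fst]
        ring
    | zero => exact ⟨0, by simp⟩
    | add z z' _ _ hz hz' =>
      obtain ⟨m, hm, hm'⟩ := hz
      obtain ⟨m₂, hm₂, hm₂'⟩ := hz'
      refine ⟨m + m₂, ?_, ?_⟩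
      · convert K.add_mem hm hm₂ using 1
        rw [map_add]; ring
      · convert K.add_mem hm' hm₂' using 1
        rw [map_add, Prod.fst_add]; ring
    | smul r z _ hz =>
      obtain ⟨m, hm, hm'⟩ := hz
      refine ⟨r * m, ?_, ?_⟩
      · convert K.mul_mem_left r hm using 1
        rw [map_smul, smul_eq_mul]; ring
      · convert K.mul_mem_left r hm' using 1
        rw [map_smul, smul_eq_mul, Prod.smul_fst, smul_eq_mul]; ring
  obtain ⟨z, hz1, hz2, hz3⟩ := hlift _ hxy
  have huv : u (1, v) = 1 := by
    rw [hu, ← ht]; exact Finset.sum_congr rfl fun j _ => mul_comm _ _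
  have hu0 : u (1, 0) = 0 := by simp [hu]
  -- The form takes the values `Y` at `(1, v)` and `c` at `(1, 0)`, so the relation modulo `K` lifts
  -- to an exact one.
  obtain ⟨m, hm, hm'⟩ := hrel (x • (1, v) - y • (1, 0) - z) (by
    rw [LinearMap.mem_ker, map_sub, map_sub, map_smul, map_smul, hz3]
    simp only [consForm_apply, hv, smul_eq_mul, one_mul, Pi.zero_apply, zero_mul,
      Finset.sum_const_zero]
    ring)
  rw [map_sub, map_sub, map_smul, map_smul, huv, hu0, hz2] at hm hm'
  simp only [smul_eq_mul, mul_one, mul_zero, sub_zero, Prod.fst_sub, Prod.smul_fst, hz1] at hm hm'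
  refine ⟨m, hm, ?_⟩
  convert K.neg_mem hm' using 1
  ring

/-- An element of the ideal of the `q_i` that is fixed by a projection for which `Y` is odd lies
in the ideal generated by `Y ^ 2 - c ^ 2` and all `q_i - t_i (Y - c)`. -/
lemma mem_span_of_koszulExact (h : KoszulExact (consForm c q))
    (hv : ∑ i, v i * q i = Y - c) (ht : ∑ i, t i * v i = 1) (E : A →+ A)
    (hEY : ∀ x, E (Y * x) = Y * (x - E x)) (hEc : ∀ x, E (c * x) = c * E x)
    (hEK : ∀ x ∈ Ideal.span (Set.range fun i => q i - t i * (Y - c)),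
      E x ∈ Ideal.span (Set.range fun i => q i - t i * (Y - c)))
    {f : A} (hf : f ∈ Ideal.span (Set.range q)) (hEf : E f = f) :
    f ∈ Ideal.span (Set.range fun i => q i - t i * (Y - c)) ⊔ Ideal.span {Y ^ 2 - c ^ 2} := by
  set K := Ideal.span (Set.range fun i => q i - t i * (Y - c))
  obtain ⟨r, rfl⟩ := (Submodule.mem_span_range_iff_exists_fun A).1 hf
  set f := ∑ i, r i • q i with hfdef
  set x := ∑ i, r i * t i with hx
  have hfx : f - (Y * x - c * x) ∈ K := by
    have : f - (Y * x - c * x) = ∑ i, r i * (q i - t i * (Y - c)) := by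
      simp only [hfdef, hx, smul_eq_mul, mul_sub, Finset.sum_sub_distrib, ← mul_assoc,
        Finset.mul_sum]
      congr 2 <;> exact Finset.sum_congr rfl fun i _ => by ring
    rw [this]
    exact sum_mem fun i _ => K.mul_mem_left _ (Ideal.subset_span ⟨i, rfl⟩)
  -- Since `E f = f`, passing to odd parts eliminates `f`.
  have hodd : Y * E x - c * (x - E x) ∈ K := by
    have h1 := K.sub_mem (hEK _ hfx) hfx
    rw [map_sub, map_sub, hEY, hEc, hEf] at h1
    convert h1 using 1
    ring
  obtain ⟨m, hm, hm'⟩ := exists_sub_mul_mem_of_koszulExact h hv ht hodd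
  refine Submodule.mem_sup.2 ⟨_, K.add_mem hfx (K.mul_mem_left (Y - c) (K.add_mem hm hm')),
    m * (Y ^ 2 - c ^ 2), Ideal.mul_mem_left _ _ (Ideal.mem_span_singleton_self _), ?_⟩
  ring

end Koszul

/-! ### Subgroups of index two and the group ring -/

section IndexTwo

variable {R Λ : Type*} [CommRing R] [AddCommGroup Λ] {T : AddSubgroup Λ}

lemma restrictSupport_eq_self {p : Λ → Prop} {f : R[Λ]} (hf : ∀ l ∈ f.coeff.support, p l) :
    restrictSupport p f = f := by
  classical
  ext l
  rw [coeff_restrictSupport]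
  split_ifs with h
  · rfl
  · exact (Finsupp.notMem_support_iff.1 fun hl => h (hf l hl)).symm

lemma restrictSupport_not (p : Λ → Prop) (f : R[Λ]) :
    restrictSupport (fun l => ¬ p l) f = f - restrictSupport p f := by
  classical
  ext l
  rw [AddMonoidAlgebra.coeff_sub, Finsupp.sub_apply, coeff_restrictSupport, coeff_restrictSupport]
  split_ifs <;> simp_all

lemma restrictSupport_mul_of_even {q : R[Λ]} (hq : ∀ l ∈ q.coeff.support, l ∈ T) (f : R[Λ]) :
    restrictSupport (· ∈ T) (q * f) = q * restrictSupport (· ∈ T) f :=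
  restrictSupport_mul (fun l hl _ => T.add_mem_cancel_left (hq l hl)) f

lemma add_mem_iff_notMem_of_index_two (hT : T.index = 2) {l m : Λ} (hl : l ∉ T) :
    l + m ∈ T ↔ m ∉ T := by
  rw [AddSubgroup.add_mem_iff_of_index_two hT]
  tauto

lemma restrictSupport_mul_of_odd (hT : T.index = 2) {q : R[Λ]}
    (hq : ∀ l ∈ q.coeff.support, l ∉ T) (f : R[Λ]) :
    restrictSupport (· ∈ T) (q * f) = q * (f - restrictSupport (· ∈ T) f) := by
  rw [← restrictSupport_not]
  exact restrictSupport_mul (fun l hl _ => add_mem_iff_notMem_of_index_two hT (hq l hl)) f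

lemma mem_range_mapDomain_of_restrictSupport {f : R[Λ]} (hf : restrictSupport (· ∈ T) f = f) :
    f ∈ Set.range (AddMonoidAlgebra.mapDomainRingHom R T.subtype) := by
  classical
  refine ⟨AddMonoidAlgebra.comapDomain T.subtype T.subtype_injective f,
    AddMonoidAlgebra.mapDomain_comapDomain (fun l hl => ?_) _⟩
  by_contra h
  rw [Finset.mem_coe, Finsupp.mem_support_iff, ← hf, coeff_restrictSupport,
    if_neg (fun h' => h ⟨⟨l, h'⟩, rfl⟩)] at hl
  exact hl rfl

lemma support_mapDomain_subtype (g : R[T]) :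
    ∀ l ∈ (AddMonoidAlgebra.mapDomainRingHom R T.subtype g).coeff.support, l ∈ T := by
  classical
  intro l hl
  have h1 := Finsupp.mapDomain_support hl
  obtain ⟨m, -, rfl⟩ := Finset.mem_image.1 h1
  exact m.2

lemma restrictSupport_restrictSupport (p : Λ → Prop) (f : R[Λ]) :
    restrictSupport p (restrictSupport p f) = restrictSupport p f := by
  classical
  refine restrictSupport_eq_self fun l hl => ?_
  rw [Finsupp.mem_support_iff, coeff_restrictSupport] at hl
  by_contra h
  exact hl (if_neg h)

/-- The contraction to `R[T]` of an ideal generated by elements of `R[T]`. -/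
lemma mem_span_preimage_of_mem_span {S : Set R[Λ]}
    (hS : S ⊆ Set.range (AddMonoidAlgebra.mapDomainRingHom R T.subtype)) {g : R[T]}
    (hg : AddMonoidAlgebra.mapDomainRingHom R T.subtype g ∈ Ideal.span S) :
    g ∈ Ideal.span (AddMonoidAlgebra.mapDomainRingHom R T.subtype ⁻¹' S) := by
  set φ := AddMonoidAlgebra.mapDomainRingHom R T.subtype with hφ
  set J := Ideal.span (φ ⁻¹' S)
  have hinj : Function.Injective φ := AddMonoidAlgebra.mapDomain_injective T.subtype_injective
  -- The generators are even, so taking the even part of a combination amounts to taking the even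
  -- parts of its coefficients.
  have key : ∀ f ∈ Ideal.span S,
      restrictSupport (· ∈ T) f ∈ (J.toAddSubgroup).map φ.toAddMonoidHom := by
    intro f hf
    obtain ⟨c, rfl⟩ := (Finsupp.mem_span_iff_linearCombination R[Λ] S f).1 hf
    rw [Finsupp.linearCombination_apply, Finsupp.sum, map_sum]
    refine sum_mem fun s _ => ?_
    obtain ⟨s', hs'⟩ := hS s.2
    obtain ⟨c', hc'⟩ := mem_range_mapDomain_of_restrictSupport
      (restrictSupport_restrictSupport (· ∈ T) (c s))
    have hs : ∀ l ∈ (s : R[Λ]).coeff.support, l ∈ T := hs' ▸ support_mapDomain_subtype s'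
    refine ⟨s' * c', J.mul_mem_right _ (Ideal.subset_span ?_), ?_⟩
    · change φ s' ∈ S
      rw [hs']; exact s.2
    · rw [smul_eq_mul, mul_comm (c s), restrictSupport_mul_of_even hs, ← hc', ← hs']
      exact map_mul φ s' c'
  obtain ⟨g', hg', h⟩ := key _ hg
  rw [restrictSupport_eq_self (support_mapDomain_subtype g)] at h
  rwa [← hinj h]

end IndexTwo

/-! ### The list of generators -/

section Generators

variable {n : ℕ}

lemma mem_tailIndices {n' : ℕ} {i j : Fin n} : j ∈ tailIndices n' i ↔ i ≤ j ∧ (j : ℕ) < n' := by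
  simp [tailIndices]

lemma tailGcd_dvd {n' : ℕ} (s : Fin n → ℕ) {i j : Fin n} (hj : j ∈ tailIndices n' i) :
    tailGcd n' s i ∣ s j :=
  Finset.gcd_dvd hj

lemma tailGcd_pos {n' : ℕ} {s : Fin n → ℕ} (hs : ∀ j, 0 < s j) {i : Fin n} (hi : (i : ℕ) < n') :
    0 < tailGcd n' s i :=
  Nat.pos_of_dvd_of_pos (tailGcd_dvd s (mem_tailIndices.2 ⟨le_rfl, hi⟩)) (hs i)

/-- The linear relations between the integers `s_j` are generated by those which express the least
common multiple of `s_i` and the greatest common divisor of the subsequent `s_j` in two ways. -/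
lemma sum_zsmul_mem_of_relations {A : Type*} [AddCommGroup A] (I : AddSubgroup A) {n' : ℕ}
    (hn' : n' ≤ n) {s : Fin n → ℕ} (hs : ∀ j, 0 < s j) {a : Fin n → Fin n → ℤ}
    (ha : IsGcdPresentation n' s a) (y : Fin n → A)
    (hI : ∀ i i' : Fin n, (i' : ℕ) = i + 1 → (i' : ℕ) < n' →
      (Nat.lcm (s i) (tailGcd n' s i') / s i) • y i -
        (Nat.lcm (s i) (tailGcd n' s i') / tailGcd n' s i') •
          ∑ j ∈ tailIndices n' i', a i' j • y j ∈ I)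
    (m : ℕ) (c : Fin n → ℤ) (hc : ∀ j, c j ≠ 0 → m ≤ j ∧ (j : ℕ) < n')
    (hsum : ∑ j, c j * s j = 0) : ∑ j, c j • y j ∈ I := by
  induction hk : n' - m generalizing m c with
  | zero =>
    have : ∀ j, c j = 0 := fun j => by
      by_contra h
      have := hc j h
      omega
    simp [this]
  | succ k ih =>
    let i : Fin n := ⟨m, by omega⟩
    have hsplit : c i * s i + ∑ j ∈ Finset.univ.erase i, c j * s j = 0 :=
      (Finset.add_sum_erase _ (fun j => c j * (s j : ℤ)) (Finset.mem_univ i)).trans hsum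
    have hsi : (s i : ℤ) ≠ 0 := by exact_mod_cast (hs i).ne'
    by_cases hm : m + 1 < n'
    · let i' : Fin n := ⟨m + 1, by omega⟩
      have hrel := hI i i' rfl hm
      have hgcd := ha i' hm
      set d := tailGcd n' s i' with hd
      have hdpos : 0 < d := tailGcd_pos hs hm
      obtain ⟨p, hp⟩ := Nat.dvd_lcm_left (s i) d
      obtain ⟨p', hp'⟩ := Nat.dvd_lcm_right (s i) d
      have h1 : Nat.lcm (s i) d / s i = p := by rw [hp]; exact Nat.mul_div_cancel_left p (hs i)
      have h2 : Nat.lcm (s i) d / d = p' := by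
        rw [hp']; exact Nat.mul_div_cancel_left p' hdpos
      rw [h1, h2] at hrel
      -- The other terms of the relation have index beyond `i`, so `d` divides each of them. Hence
      -- the lcm of `s i` and `d` divides `c i * s i`.
      have hdvd : (d : ℤ) ∣ c i * s i := by
        rw [eq_neg_of_add_eq_zero_left hsplit, dvd_neg]
        refine Finset.dvd_sum fun j hj => ?_
        by_cases hcj : c j = 0
        · simp [hcj]
        · have h3 := hc j hcj
          have h4 : (j : ℕ) ≠ m := fun h => (Finset.ne_of_mem_erase hj) (Fin.ext h)
          refine Dvd.dvd.mul_left (Int.natCast_dvd_natCast.2 (tailGcd_dvd s ?_)) _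
          exact mem_tailIndices.2 ⟨Fin.mk_le_of_le_val (by omega), h3.2⟩
      obtain ⟨z, hz⟩ : (p : ℤ) ∣ c i := by
        have h3 : ((Nat.lcm (s i) d : ℕ) : ℤ) ∣ c i * s i := by
          rw [Int.natCast_dvd]
          exact Nat.lcm_dvd (Int.natCast_dvd.1 (dvd_mul_left _ _)) (Int.natCast_dvd.1 hdvd)
        rw [hp, Nat.cast_mul, mul_comm (c i)] at h3
        exact (mul_dvd_mul_iff_left hsi).1 h3
      have hpp : (s i : ℤ) * p = d * p' := by exact_mod_cast hp.symm.trans hp'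
      let c₀ : Fin n → ℤ := fun j => if j ∈ tailIndices n' i' then a i' j else 0
      have hc₀ : ∀ j, c₀ j ≠ 0 → m + 1 ≤ j ∧ (j : ℕ) < n' := by
        intro j hj
        by_cases hmem : j ∈ tailIndices n' i'
        · exact ⟨(mem_tailIndices.1 hmem).1, (mem_tailIndices.1 hmem).2⟩
        · exact absurd (if_neg hmem) hj
      have hc₀s : ∑ j, c₀ j * s j = d := by
        rw [hgcd]; simp [c₀, ite_mul, Finset.sum_ite_mem]
      have hc₀y : ∑ j, c₀ j • y j = ∑ j ∈ tailIndices n' i', a i' j • y j := by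
        simp [c₀, ite_smul, Finset.sum_ite_mem]
      -- As `c i = p * z`, subtracting `z` times the given relation kills the coefficient at `i`;
      -- `c₀` lives beyond `i`.
      have hmem := ih (m + 1) (c - z • ((p : ℤ) • Pi.single i 1 - (p' : ℤ) • c₀))
        (fun j hj => ?_) ?_ (by omega)
      · have h5 : ∑ j, (c - z • ((p : ℤ) • Pi.single i 1 - (p' : ℤ) • c₀) : Fin n → ℤ) j • y j =
            ∑ j, c j • y j - z • (p • y i - p' • ∑ j ∈ tailIndices n' i', a i' j • y j) := by
          rw [← hc₀y]
          simp only [Pi.sub_apply, Pi.smul_apply, sub_smul, smul_assoc, Finset.sum_sub_distrib,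
            ← Finset.smul_sum, Pi.single_apply, ite_smul, one_smul, zero_smul,
            Finset.sum_ite_eq', Finset.mem_univ, if_true, natCast_zsmul]
        rw [h5] at hmem
        simpa using I.add_mem hmem (I.zsmul_mem hrel z)
      · by_cases hji : j = i
        · subst hji
          refine absurd ?_ hj
          have h6 : c₀ i = 0 := by
            by_contra h
            have := (hc₀ i h).1
            simp only [i] at this
            omega
          simp [h6, hz, mul_comm]
        · by_cases hcj : c j = 0
          · refine hc₀ j fun h => hj ?_
            simp [hcj, h, hji]
          · have h3 := hc j hcj
            have h4 : (j : ℕ) ≠ m := fun h => hji (Fin.ext h)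
            exact ⟨by omega, h3.2⟩
      · simp only [Pi.sub_apply, Pi.smul_apply, sub_mul, smul_eq_mul, Finset.sum_sub_distrib,
          mul_assoc, ← Finset.mul_sum, hsum, hc₀s]
        simp only [Pi.single_apply, ite_mul, one_mul, zero_mul, Finset.sum_ite_eq',
          Finset.mem_univ, if_true]
        linear_combination (-z) * hpp
    · have hz : ∀ j, j ≠ i → c j = 0 := fun j hj => by
        by_contra h
        have h3 := hc j h
        exact hj (Fin.ext (show (j : ℕ) = m by omega))
      have hci : c i = 0 := by
        rw [Finset.sum_eq_zero fun j hj => by rw [hz j (Finset.ne_of_mem_erase hj), zero_mul],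
          add_zero] at hsplit
        exact (mul_eq_zero.1 hsplit).resolve_right hsi
      have hall : ∀ j, c j = 0 := fun j => by
        by_cases hj : j = i
        · rw [hj, hci]
        · exact hz j hj
      simp [hall]

end Generators

namespace RootPairing

variable {ι k M N : Type*} [Field k] [CharZero k] [AddCommGroup M] [Module k M]
  [AddCommGroup N] [Module k N] (P : RootPairing ι k M N) [P.IsCrystallographic]

/-! ### Parity of weights and orbit sums -/

section Parity

variable {P} {T : AddSubgroup P.weightLattice} (hroot : ∀ i, P.rootWeight i ∈ T)

include hroot

/-- A reflection moves a weight by a multiple of a root, so parity is constant on orbits. -/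
lemma smul_sub_mem_of_rootWeight_mem (g : P.weylGroup) (v : P.weightLattice) : g • v - v ∈ T := by
  obtain ⟨g, hg⟩ := g
  induction hg using weylGroup.induction generalizing v with
  | mem i =>
    have h := P.ofIdx_smul_weight i v
    have h2 : weylGroup.ofIdx P i • v - v ∈ T := by
      rw [h, sub_sub_cancel_left]
      exact neg_mem (zsmul_mem (hroot i) _)
    exact h2
  | one =>
    have h : (1 : P.weylGroup) • v - v ∈ T := by rw [one_smul, sub_self]; exact zero_mem _
    exact h
  | mul x y hx hy ihx ihy =>
    have h : ((⟨x, hx⟩ : P.weylGroup) * ⟨y, hy⟩) • v - v ∈ T := by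
      rw [mul_smul]
      have := add_mem (ihx ((⟨y, hy⟩ : P.weylGroup) • v)) (ihy v)
      rwa [sub_add_sub_cancel] at this
    exact h

lemma mem_iff_of_mem_support_orbitSum [P.IsRootSystem] [Finite ι] {v l : P.weightLattice}
    (hl : l ∈ (P.orbitSum v).coeff.support) : l ∈ T ↔ v ∈ T := by
  classical
  rw [Finsupp.mem_support_iff, coeff_orbitSum] at hl
  obtain ⟨g, rfl⟩ : ∃ g : P.weylGroup, g • v = l := by by_contra h; simp [h] at hl
  have := smul_sub_mem_of_rootWeight_mem hroot g v
  constructor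
  · intro h
    simpa using T.sub_mem h this
  · intro h
    simpa using T.add_mem this h

end Parity

/-- The fundamental weights generate the weight lattice. This ensures `0 < n'`, so that Y is
available. -/
lemma Base.exists_fundamentalWeight_notMem [Finite ι]
    {P : RootPairing ι k M N} [P.IsCrystallographic] [P.IsRootSystem] (b : P.Base)
    {T : AddSubgroup P.weightLattice} (hT : T ≠ ⊤) : ∃ i, b.fundamentalWeight i ∉ T := by
  classical
  by_contra! h
  refine hT ((AddSubgroup.eq_top_iff' T).2 fun v => ?_)
  have hv : v = ∑ i : b.support, P.intPairing i v • b.fundamentalWeight i := by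
    rw [← sub_eq_zero]
    refine Base.eq_zero_of_intPairing_eq_zero (b := b) fun j hj => ?_
    have h1 : ∀ i : b.support, P.intPairing j (b.fundamentalWeight i) =
      if (⟨j, hj⟩ : b.support) = i then 1 else 0 := fun i =>
        Base.intPairing_fundamentalWeight i ⟨j, hj⟩
    simp [map_sub, map_sum, h1]
  rw [hv]
  exact sum_mem fun i _ => zsmul_mem (h i) _

variable [P.IsRootSystem] [Finite ι] {n : ℕ} {w : Fin n → P.weightLattice} {n' : ℕ}
  {a : Fin n → Fin n → ℤ} {l₀ : P.weightLattice}

/-- The constants cancel by the choice of the `a i j`; this makes ρ̃(ω_i) odd. -/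
lemma tildeOrbitSum_eq_sum (ha : IsGcdPresentation n' (fun j => P.orbitCard (w j)) a) {i : Fin n}
    (hi : (i : ℕ) < n') :
    P.tildeOrbitSum w n' a i = ∑ j ∈ tailIndices n' i, a i j • P.orbitSum (w j) := by
  have h := congrArg (Int.cast : ℤ → ℤ[P.weightLattice]) (ha i hi)
  push_cast at h
  rw [tildeOrbitSum, tildeAugOrbitSum, h, ← Finset.sum_add_distrib]
  refine Finset.sum_congr rfl fun j _ => ?_
  simp only [augOrbitSum, zsmul_eq_mul]
  ring

/-! ### The generators: membership, parity, and generation -/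

section Generators

variable {T : AddSubgroup P.weightLattice}

lemma generatorSet_subset_span :
    P.generatorSet w n' a l₀ ⊆ Ideal.span (Set.range fun i => P.augOrbitSum (w i)) := by
  set I := Ideal.span (Set.range fun i => P.augOrbitSum (w i))
  have hρ : ∀ i, P.augOrbitSum (w i) ∈ I := fun i => Ideal.subset_span ⟨i, rfl⟩
  have htilde : ∀ i, P.tildeAugOrbitSum w n' a i ∈ I := fun i =>
    sum_mem fun j _ => by rw [zsmul_eq_mul]; exact I.mul_mem_left _ (hρ j)
  have hsum : ∀ i, P.orbitSum (w i) = P.augOrbitSum (w i) + (P.orbitCard (w i) : ℤ[P.weightLattice]) :=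
    fun i => (sub_add_cancel _ _).symm
  rintro f ((⟨i, i', -, -, rfl⟩ | ⟨i₁, i, -, -, rfl⟩) | ⟨i, -, rfl⟩)
  · refine I.mul_mem_left _ ?_
    simp only
    set s := fun j => P.orbitCard (w j)
    set d := tailGcd n' s i'
    -- Both constant terms equal the lcm, so they cancel.
    have h1 : (((Nat.lcm (s i) d / s i) * s i : ℕ) : ℤ[P.weightLattice]) =
        (((Nat.lcm (s i) d / d) * d : ℕ) : ℤ[P.weightLattice]) := by
      rw [Nat.div_mul_cancel (Nat.dvd_lcm_left _ _), Nat.div_mul_cancel (Nat.dvd_lcm_right _ _)]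
    have h2 : (Nat.lcm (s i) d / s i) • P.orbitSum (w i) -
        (Nat.lcm (s i) d / d) • P.tildeOrbitSum w n' a i' =
        ((Nat.lcm (s i) d / s i : ℕ) : ℤ[P.weightLattice]) * P.augOrbitSum (w i) -
        ((Nat.lcm (s i) d / d : ℕ) : ℤ[P.weightLattice]) * P.tildeAugOrbitSum w n' a i' := by
      push_cast at h1
      rw [nsmul_eq_mul, nsmul_eq_mul, hsum, tildeOrbitSum]
      linear_combination h1
    rw [h2]
    exact I.sub_mem (I.mul_mem_left _ (hρ i)) (I.mul_mem_left _ (htilde i'))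
  · have h2 : P.genTwo w n' a i₁ i =
        P.augOrbitSum (w i) * P.tildeOrbitSum w n' a i₁ +
          (P.orbitCard (w i) : ℤ[P.weightLattice]) * P.tildeAugOrbitSum w n' a i₁ := by
      simp only [genTwo, tildeOrbitSum, hsum]
      push_cast
      ring
    rw [h2]
    exact I.add_mem (I.mul_mem_right _ (hρ i)) (I.mul_mem_left _ (htilde i₁))
  · exact hρ i

lemma mem_of_mem_support_natCast {Λ : Type*} [AddCommGroup Λ] {T : AddSubgroup Λ} (m : ℕ) :
    ∀ l ∈ ((m : ℤ[Λ])).coeff.support, l ∈ T := by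
  intro l hl
  rw [AddMonoidAlgebra.coeff_natCast] at hl
  rw [Finset.mem_singleton.1 (Finsupp.support_single_subset hl)]
  exact zero_mem T

lemma support_sub_subset {Λ : Type*} [AddCommGroup Λ] {p : Λ → Prop} {f g : ℤ[Λ]}
    (hf : ∀ l ∈ f.coeff.support, p l) (hg : ∀ l ∈ g.coeff.support, p l) :
    ∀ l ∈ (f - g).coeff.support, p l :=
  (AddMonoidAlgebra.supported ℤ ℤ {l | p l}).sub_mem hf hg

lemma support_zsmul_subset {Λ : Type*} [AddCommGroup Λ] {p : Λ → Prop} {f : ℤ[Λ]} (z : ℤ)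
    (hf : ∀ l ∈ f.coeff.support, p l) : ∀ l ∈ (z • f).coeff.support, p l :=
  (AddMonoidAlgebra.supported ℤ ℤ {l | p l}).smul_mem z hf

variable (hroot : ∀ i, P.rootWeight i ∈ T) (hindex : T.index = 2)
  (hdeg : ∀ i : Fin n, w i ∉ T ↔ (i : ℕ) < n')

include hroot hdeg

lemma orbitSum_odd {i : Fin n} (hi : (i : ℕ) < n') :
    ∀ l ∈ (P.orbitSum (w i)).coeff.support, l ∉ T := fun _ hl h =>
  (hdeg i).2 hi ((mem_iff_of_mem_support_orbitSum hroot hl).1 h)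

lemma augOrbitSum_even {i : Fin n} (hi : n' ≤ (i : ℕ)) :
    ∀ l ∈ (P.augOrbitSum (w i)).coeff.support, l ∈ T := by
  have hw : w i ∈ T := by
    by_contra h
    have := (hdeg i).1 h
    omega
  exact support_sub_subset (p := (· ∈ T))
    (fun l hl => (mem_iff_of_mem_support_orbitSum hroot hl).2 hw) (mem_of_mem_support_natCast _)

lemma tildeOrbitSum_odd (ha : IsGcdPresentation n' (fun j => P.orbitCard (w j)) a) {i : Fin n}
    (hi : (i : ℕ) < n') : ∀ l ∈ (P.tildeOrbitSum w n' a i).coeff.support, l ∉ T := by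
  rw [P.tildeOrbitSum_eq_sum ha hi]
  exact (AddMonoidAlgebra.supported ℤ ℤ {l | l ∉ T}).sum_mem fun j hj =>
    Submodule.smul_mem _ _ (P.orbitSum_odd hroot hdeg (mem_tailIndices.1 hj).2)

include hindex

lemma generatorSet_subset_range (ha : IsGcdPresentation n' (fun j => P.orbitCard (w j)) a)
    (hl₀ : l₀ ∉ T) :
    P.generatorSet w n' a l₀ ⊆ Set.range (sublatticeInclusion T) := by
  have hmul : ∀ f g : ℤ[P.weightLattice], (∀ l ∈ f.coeff.support, l ∉ T) →
      (∀ l ∈ g.coeff.support, l ∉ T) → restrictSupport (· ∈ T) (f * g) = f * g := by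
    intro f g hf hg
    rw [restrictSupport_mul_of_odd hindex hf, ← restrictSupport_not, restrictSupport_eq_self hg]
  rintro f ((⟨i, i', hi, hi', rfl⟩ | ⟨i₁, i, hi₁, hi, rfl⟩) | ⟨i, hi, rfl⟩)
  · refine mem_range_mapDomain_of_restrictSupport (hmul _ _ (fun l hl => ?_) ?_)
    · rw [AddMonoidAlgebra.coeff_single] at hl
      rwa [Finset.mem_singleton.1 (Finsupp.support_single_subset hl)]
    · refine support_sub_subset (p := (· ∉ T)) ?_ ?_
      · rw [← natCast_zsmul]
        exact support_zsmul_subset _ (P.orbitSum_odd hroot hdeg (by omega))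
      · rw [← natCast_zsmul]
        exact support_zsmul_subset _ (P.tildeOrbitSum_odd hroot hdeg ha hi')
  · refine mem_range_mapDomain_of_restrictSupport ?_
    simp only [genTwo]
    rw [map_sub, hmul _ _ (P.orbitSum_odd hroot hdeg hi)
      (P.tildeOrbitSum_odd hroot hdeg ha (by omega)),
      restrictSupport_eq_self (mem_of_mem_support_natCast _)]
  · exact mem_range_mapDomain_of_restrictSupport
      (restrictSupport_eq_self (P.augOrbitSum_even hroot hdeg hi))

lemma mem_span_generatorSet (hn' : n' ≤ n) {i₁ : Fin n} (hi₁ : (i₁ : ℕ) = 0) (hi₁n' : 0 < n')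
    (ha : IsGcdPresentation n' (fun j => P.orbitCard (w j)) a)
    (hkoszul : ∀ c : ℤ, c ≠ 0 →
      KoszulExact (consForm (AddMonoidAlgebra.single 0 c) fun i => P.augOrbitSum (w i)))
    {f : ℤ[P.weightLattice]} (hf : f ∈ Ideal.span (Set.range fun i => P.augOrbitSum (w i)))
    (hfT : restrictSupport (· ∈ T) f = f) : f ∈ Ideal.span (P.generatorSet w n' a l₀) := by
  set J := Ideal.span (P.generatorSet w n' a l₀) with hJ
  let s : Fin n → ℕ := fun j => P.orbitCard (w j)
  have hs : ∀ j, 0 < s j := fun j => P.orbitCard_pos (w j)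
  set d := tailGcd n' s i₁ with hd
  have hi₁' : (i₁ : ℕ) < n' := by omega
  have hdpos : 0 < d := tailGcd_pos hs hi₁'
  have htail : ∀ j : Fin n, j ∈ tailIndices n' i₁ ↔ (j : ℕ) < n' := fun j => by
    rw [mem_tailIndices]
    exact ⟨fun h => h.2, fun h => ⟨Fin.le_def.2 (by omega), h⟩⟩
  have hdvd : ∀ j : Fin n, (j : ℕ) < n' → s j / d * d = s j := fun j hj =>
    Nat.div_mul_cancel (tailGcd_dvd s ((htail j).2 hj))
  set Y := P.tildeOrbitSum w n' a i₁ with hY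
  have hYsum : Y = ∑ j ∈ tailIndices n' i₁, a i₁ j • P.orbitSum (w j) :=
    P.tildeOrbitSum_eq_sum ha hi₁'
  -- Extension by zero lets one formula treat the even `w i`, whose augmented orbit sums need no
  -- correction, together with the odd ones.
  let t : Fin n → ℤ := fun i => if (i : ℕ) < n' then ((s i / d : ℕ) : ℤ) else 0
  let v : Fin n → ℤ := fun i => if i ∈ tailIndices n' i₁ then a i₁ i else 0
  have hvs : ∑ i, v i * (s i : ℤ) = d := by
    rw [hd, ha i₁ hi₁']; simp [v, ite_mul, Finset.sum_ite_mem, s]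
  have htv : ∑ i, t i * v i = 1 := by
    have hd0 : (d : ℤ) ≠ 0 := by exact_mod_cast hdpos.ne'
    refine mul_right_cancel₀ hd0 ?_
    rw [Finset.sum_mul, one_mul]
    refine Eq.trans ?_ hvs
    refine Finset.sum_congr rfl fun i _ => ?_
    by_cases hi : (i : ℕ) < n'
    · have h1 : ((s i / d : ℕ) : ℤ) * d = s i := by exact_mod_cast hdvd i hi
      simp only [t, if_pos hi]
      linear_combination (v i) * h1
    · have h1 : v i = 0 := if_neg (fun h => hi ((htail i).1 h))
      simp [h1]
  have hY0 : ∑ i, (v i : ℤ[P.weightLattice]) * P.augOrbitSum (w i) =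
      Y - (d : ℤ[P.weightLattice]) := by
    rw [hY, tildeOrbitSum, add_sub_cancel_right, tildeAugOrbitSum]
    simp [v, ite_mul, Finset.sum_ite_mem, zsmul_eq_mul, apply_ite (Int.cast : ℤ → ℤ[P.weightLattice])]
  have hYv : ∑ i, v i • P.orbitSum (w i) = Y := by
    rw [hYsum]; simp [v, ite_smul, Finset.sum_ite_mem]
  have hcast : AddMonoidAlgebra.single (0 : P.weightLattice) (d : ℤ) = (d : ℤ[P.weightLattice]) :=
    (AddMonoidAlgebra.natCast_def d).symm
  have hYodd : ∀ l ∈ Y.coeff.support, l ∉ T := P.tildeOrbitSum_odd hroot hdeg ha hi₁'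
  -- The constants `s i` and `t i * d` cancel, leaving an odd element.
  have hlow : ∀ i : Fin n, (i : ℕ) < n' → P.augOrbitSum (w i) -
      (t i : ℤ[P.weightLattice]) * (Y - (d : ℤ[P.weightLattice])) = P.orbitSum (w i) - t i • Y := by
    intro i hi
    have h1 : ((s i / d : ℕ) : ℤ[P.weightLattice]) * d = s i := by
      rw [← Nat.cast_mul, hdvd i hi]
    simp only [t, if_pos hi, augOrbitSum, zsmul_eq_mul, Int.cast_natCast]
    change P.orbitSum (w i) - (s i : ℤ[P.weightLattice]) - _ = _
    linear_combination h1
  have hhigh : ∀ i : Fin n, ¬ (i : ℕ) < n' → P.augOrbitSum (w i) -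
      (t i : ℤ[P.weightLattice]) * (Y - (d : ℤ[P.weightLattice])) = P.augOrbitSum (w i) := by
    intro i hi
    simp only [t, if_neg hi, Int.cast_zero, zero_mul, sub_zero]
  have htv' : ∑ i, (t i : ℤ[P.weightLattice]) * (v i : ℤ[P.weightLattice]) = 1 := by
    rw [← Int.cast_one, ← htv, Int.cast_sum]
    exact Finset.sum_congr rfl fun i _ => (Int.cast_mul _ _).symm
  have hE := mem_span_of_koszulExact (E := restrictSupport (· ∈ T)) (c := (d : ℤ[P.weightLattice]))
    (Y := Y) (t := fun i => (t i : ℤ[P.weightLattice])) (v := fun i => (v i : ℤ[P.weightLattice]))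
    (hcast ▸ hkoszul d (by exact_mod_cast hdpos.ne')) hY0 htv'
    (restrictSupport_mul_of_odd hindex hYodd)
    (restrictSupport_mul_of_even (mem_of_mem_support_natCast d))
    (fun x hx => restrictSupport_mem_span (by
      rintro _ ⟨i, rfl⟩
      by_cases hi : (i : ℕ) < n'
      · refine ⟨(· ∉ T), fun l hl m => ?_⟩
        simp only [hlow i hi] at hl
        exact add_mem_iff_notMem_of_index_two hindex (support_sub_subset (p := (· ∉ T))
          (P.orbitSum_odd hroot hdeg hi) (support_zsmul_subset _ hYodd) l hl)
      · refine ⟨(· ∈ T), fun l hl m => ?_⟩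
        simp only [hhigh i hi] at hl
        exact T.add_mem_cancel_left (P.augOrbitSum_even hroot hdeg (by omega) l hl)) hx)
    hf hfT
  refine (sup_le (Ideal.span_le.2 ?_) (Ideal.span_le.2 ?_) : _ ≤ J) hE
  · rintro _ ⟨i, rfl⟩
    by_cases hi : (i : ℕ) < n'
    · simp only [hlow i hi]
      -- The coefficients `Pi.single i 1 - t i • v` form a relation because `s i = t i * d`. In ℤ[Λ]
      -- the factor e^{λ₀} of each h_{1,j} is a unit and can be removed.
      have hrel := sum_zsmul_mem_of_relations J.toAddSubgroup hn' hs ha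
        (fun j => P.orbitSum (w j)) (fun j j' hj hj' => by
          have h1 : P.genOne w n' a l₀ j j' ∈ J :=
            Ideal.subset_span (Or.inl (Or.inl ⟨j, j', hj, hj', rfl⟩))
          have h2 := J.mul_mem_left (AddMonoidAlgebra.single (-l₀) 1) h1
          rw [genOne, ← mul_assoc, AddMonoidAlgebra.single_mul_single, neg_add_cancel, one_mul,
            ← AddMonoidAlgebra.one_def, one_mul, P.tildeOrbitSum_eq_sum ha hj'] at h2
          exact h2) 0 (Pi.single i 1 - t i • v) (fun j hj => ⟨Nat.zero_le _, ?_⟩) ?_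
      · simp only [Pi.sub_apply, Pi.smul_apply, sub_smul, smul_assoc, Finset.sum_sub_distrib,
          ← Finset.smul_sum, hYv, Pi.single_apply, ite_smul, one_smul, zero_smul,
          Finset.sum_ite_eq', Finset.mem_univ, if_true] at hrel
        exact hrel
      · by_contra h
        have h1 : v j = 0 := if_neg fun h' => h ((htail j).1 h')
        have h2 : j ≠ i := fun h' => h (h' ▸ hi)
        exact hj (by simp [h1, h2])
      · have h1 : ((s i / d : ℕ) : ℤ) * d = s i := by exact_mod_cast hdvd i hi
        simp only [Pi.sub_apply, Pi.smul_apply, sub_mul, smul_eq_mul, Finset.sum_sub_distrib,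
          mul_assoc, ← Finset.mul_sum, hvs]
        simp only [Pi.single_apply, ite_mul, one_mul, zero_mul, Finset.sum_ite_eq',
          Finset.mem_univ, if_true, t, if_pos hi]
        linear_combination -h1
    · simp only [hhigh i hi]
      exact Ideal.subset_span (Or.inr ⟨i, by omega, rfl⟩)
  · rw [Set.singleton_subset_iff]
    have h1 : Y ^ 2 - (d : ℤ[P.weightLattice]) ^ 2 =
        ∑ i ∈ tailIndices n' i₁, a i₁ i • P.genTwo w n' a i₁ i := by
      have h2 : (d : ℤ[P.weightLattice]) = ∑ i ∈ tailIndices n' i₁,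
          (a i₁ i : ℤ[P.weightLattice]) * (P.orbitCard (w i) : ℤ[P.weightLattice]) := by
        have h3 := congrArg (Int.cast : ℤ → ℤ[P.weightLattice]) (ha i₁ hi₁')
        push_cast at h3
        exact h3
      have h4 : ∀ i, a i₁ i • P.genTwo w n' a i₁ i = a i₁ i • P.orbitSum (w i) * Y -
          d * ((a i₁ i : ℤ[P.weightLattice]) * (P.orbitCard (w i) : ℤ[P.weightLattice])) := by
        intro i
        have h5 : P.genTwo w n' a i₁ i = P.orbitSum (w i) * Y -
          ((d * P.orbitCard (w i) : ℕ) : ℤ[P.weightLattice]) := rfl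
        rw [h5, zsmul_eq_mul, zsmul_eq_mul, Nat.cast_mul]
        ring
      rw [Finset.sum_congr rfl fun i _ => h4 i, Finset.sum_sub_distrib, ← Finset.sum_mul,
        ← Finset.mul_sum, ← hYsum, ← h2]
      ring
    rw [h1]
    refine sum_mem fun i hi => zsmul_mem ?_ _
    exact Ideal.subset_span (Or.inl (Or.inr ⟨i₁, i, hi₁, (htail i).1 hi, rfl⟩))

end Generators

end RootPairing

end

theorem theorem3 {ι k M N : Type*} [Finite ι] [Field k] [CharZero k]
    [AddCommGroup M] [Module k M] [AddCommGroup N] [Module k N]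
    -- a semisimple root system with a base, its simple roots being numbered by `Fin n`
    (P : RootPairing ι k M N) [P.IsRootSystem] [P.IsCrystallographic] [P.IsReduced]
    (b : P.Base) {n : ℕ} (e : Fin n ≃ b.support)
    -- the character lattice, between the root lattice and the weight lattice, of index two
    (T : AddSubgroup P.weightLattice) (hroot : ∀ i, P.rootWeight i ∈ T) (hindex : T.index = 2)
    -- exactly the first `n'` fundamental weights have degree one
    (n' : ℕ) (hn' : n' ≤ n)
    (hdeg : ∀ i : Fin n, b.fundamentalWeight (e i) ∉ T ↔ (i : ℕ) < n')
    -- the choices made in the construction of the list of generators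
    (a : Fin n → Fin n → ℤ)
    (ha : IsGcdPresentation n' (fun j => P.orbitCard (b.fundamentalWeight (e j))) a)
    (l₀ : P.weightLattice) (hl₀ : l₀ ∉ T)
    -- the generalized flatness condition with respect to some basis of the weight lattice
    (x : Module.Basis (Fin n) ℤ P.weightLattice)
    (hflat : GeneralizedFlatnessCondition x
      fun i => P.augOrbitSum (b.fundamentalWeight (e i))) :
    P.generatorSet (fun i => b.fundamentalWeight (e i)) n' a l₀ ⊆
        Set.range (RootPairing.sublatticeInclusion T) ∧
      Ideal.span (RootPairing.sublatticeInclusion T ⁻¹'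
          P.generatorSet (fun i => b.fundamentalWeight (e i)) n' a l₀) =
        Ideal.comap (RootPairing.sublatticeInclusion T) P.invariantIdeal := by
  have hspan : P.invariantIdeal =
      Ideal.span (Set.range fun i => P.augOrbitSum (b.fundamentalWeight (e i))) := by
    rw [b.invariantIdeal_eq_span]
    exact congrArg Ideal.span
      (e.surjective.range_comp fun i => P.augOrbitSum (b.fundamentalWeight i)).symm
  have hrange := P.generatorSet_subset_range hroot hindex hdeg ha hl₀
  refine ⟨hrange, le_antisymm (Ideal.span_le.2 fun f hf => ?_) fun f hf => ?_⟩
  · rw [SetLike.mem_coe, Ideal.mem_comap, hspan]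
    exact P.generatorSet_subset_span hf
  · refine mem_span_preimage_of_mem_span hrange ?_
    obtain ⟨i, hi⟩ := b.exists_fundamentalWeight_notMem (T := T) (by
      rintro rfl
      rw [AddSubgroup.index_top] at hindex
      omega)
    have hpos : 0 < n' := by
      have := (hdeg (e.symm i)).1 (by rwa [e.apply_symm_apply])
      omega
    refine P.mem_span_generatorSet hroot hindex hdeg hn' (i₁ := ⟨0, by omega⟩) rfl hpos ha
      (fun c hc => hflat.koszulExact fun r hr => (mul_eq_zero.1 hr).resolve_left hc) ?_
      (restrictSupport_eq_self (support_mapDomain_subtype f))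
    rw [← hspan]
    exact hf
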